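/- \textbf{Model.} An $m\times n$ board is the rectangle $\{1,\dots,m\}\times\{1,\dots,n\}$ of lattice locations, partitioned into open and blocked ones; its size is $mn$. A tile is a location together with an attachment label; a symmetric affinity function says which labels attract each other, and two tiles at adjacent locations whose labels attract are bonded. A polyomino is a finite set of tiles at distinct locations that is connected through its bonds. A configuration is a board together with pairwise non-overlapping polyominoes on its open locations. In a step in direction $d\in\{N,E,S,W\}$, a polyomino is stuck if moving it by one unit in direction $d$ would overlap a blocked location or (recursively) a stuck polyomino; if all polyominoes are stuck, nothing changes; otherwise all polyominoes that are not stuck move by one unit, those of which a tile leaves the board are removed, and polyominoes containing the two tiles of a bonded pair are merged. A tilt in direction $d$ repeats the step in direction $d$ until the configuration no longer changes; write $C\to_* C'$ if $C'$ is obtained from $C$ by a nonempty finite sequence of tilts. Use three attachment labels $a_0,a_1,\varepsilon$, where $a_0$ and $a_1$ attract themselves and each other and $\varepsilon$ attracts nothing. An $h\times w$ binary-patterned rectangle $u$ assigns a symbol in $\{0,1\}$ to each location of a rectangle of height $h$ and width $w$. A configuration strongly represents $u$ if it consists of a single polyomino whose tiles occupy exactly a translate of this rectangle, the tile at each location carrying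 label $a_x$, where $x$ is the symbol that $u$ assigns to the corresponding location. A configuration $C$ is strongly universal for a set $U$ of patterns if there is a set $\mathcal C$ of configurations such that every $u\in U$ is strongly represented by some $C'\in\mathcal C$ and $C\to_* C'$ for all $C'\in\mathcal C$. \textbf{Theorem.} There is an absolute constant $K$ such that for all positive integers $h,w$ there is a configuration $C$, all of whose polyominoes are single tiles, such that (i) $C$ is strongly universal for the set $U$ of all $h\times w$ binary-patterned rectangles; (ii) the board of $C$ has size at most $K\,hw$; (iii) for every $u\in U$ there is a sequence of at most $K\,hw$ tilts that takes $C$ to a configuration that strongly represents $u$. -/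

import Mathlib

namespace TiltModel

/-- A location of the two-dimensional square lattice. -/
abbrev Loc := ℤ × ℤ

/-- The four directions in which a board can be tilted. -/
inductive Dir
  | N | E | S | W

/-- The unit vector of a direction. -/
def Dir.vec : Dir → Loc
  | .N => (0, 1)
  | .E => (1, 0)
  | .S => (0, -1)
  | .W => (-1, 0)

/-- Two lattice locations are adjacent if they share a side as unit squares. -/
def Adjacent (p q : Loc) : Prop := |p.1 - q.1| + |p.2 - q.2| = 1

/-- The rectangle `{1, …, m} × {1, …, n}`. -/
def box (m n : ℕ) : Set Loc := Set.Icc 1 (m : ℤ) ×ˢ Set.Icc 1 (n : ℤ)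

/-- A `width × height` board: the rectangle `box width height`, partitioned into blocked locations
(`walls`) and open locations (all the others). -/
structure Board where
  width : ℕ
  height : ℕ
  walls : Set Loc
  walls_subset : walls ⊆ box width height

/-- All locations of the board, open or blocked. -/
def Board.region (B : Board) : Set Loc := box B.width B.height

/-- The open locations of the board. -/
def Board.openLocs (B : Board) : Set Loc := B.region \ B.walls

/-- A tile: a coordinate together with an attachment label. -/
abbrev Tile (L : Type) := Loc × L

section Model

variable {L : Type}

/-- Two tiles are bonded, with respect to the affinity function `G`, if they are adjacent and
their labels attract each other in both orders. -/
def Bonded (G : L → L → Bool) (s t : Tile L) : Prop :=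
  Adjacent s.1 t.1 ∧ G s.2 t.2 = true ∧ G t.2 s.2 = true

theorem Bonded.symm {G : L → L → Bool} {s t : Tile L} (h : Bonded G s t) : Bonded G t s :=
  ⟨by have := h.1; unfold Adjacent at *; rwa [abs_sub_comm, abs_sub_comm t.1.2], h.2.2, h.2.1⟩

/-- The graph whose vertices are all tiles and whose edges join bonded tiles. -/
def bondGraph (G : L → L → Bool) : SimpleGraph (Tile L) where
  Adj := Bonded G
  symm := ⟨fun _ _ h => h.symm⟩
  loopless := ⟨fun t h => by simpa [Adjacent] using h.1⟩

/-- A polyomino: a finite set of tiles, no two at the same coordinate, connected by its bonds.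
(Bonded tiles are adjacent, so its set of coordinates is connected as well.) -/
structure IsPolyomino (G : L → L → Bool) (P : Set (Tile L)) : Prop where
  finite : P.Finite
  injOn : Set.InjOn Prod.fst P
  connected : ((bondGraph G).induce P).Connected

/-- A configuration: a board with a set of polyominoes that lie on open locations and do not
overlap. (The set of polyominoes is finite because the board is.) -/
@[ext]
structure Configuration (G : L → L → Bool) where
  board : Board
  polys : Set (Set (Tile L))
  isPolyomino : ∀ P ∈ polys, IsPolyomino G P
  onOpen : ∀ P ∈ polys, ∀ t ∈ P, t.1 ∈ board.openLocs
  nonoverlap : ∀ P ∈ polys, ∀ Q ∈ polys, ∀ s ∈ P, ∀ t ∈ Q, s.1 = t.1 → P = Q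

/-- The size of a configuration: the number of locations, open or blocked, of its board. -/
def Configuration.size {G : L → L → Bool} (C : Configuration G) : ℕ :=
  C.board.width * C.board.height

/-- The polyominoes that get marked as blocked in a step in direction `d`: those whose translate
overlaps a blocked location, and, repeatedly, those whose translate overlaps a polyomino that has
already been marked as blocked. -/
inductive Stuck (B : Board) (F : Set (Set (Tile L))) (d : Dir) : Set (Tile L) → Prop
  | wall {P : Set (Tile L)} {t : Tile L} :
      P ∈ F → t ∈ P → t.1 + d.vec ∈ B.walls → Stuck B F d P
  | push {P Q : Set (Tile L)} {t s : Tile L} :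
      P ∈ F → t ∈ P → Stuck B F d Q → s ∈ Q → t.1 + d.vec = s.1 → Stuck B F d P

/-- Translation of a set of tiles by a vector. -/
def translate (v : Loc) (P : Set (Tile L)) : Set (Tile L) := (fun t => (t.1 + v, t.2)) '' P

/-- The polyominoes after the motion of a step and before merging: the blocked ones stay in place,
the others are translated by one unit, and those with a tile that left the board are removed. -/
def moved (B : Board) (F : Set (Set (Tile L))) (d : Dir) : Set (Set (Tile L)) :=
  {R | (R ∈ F ∧ Stuck B F d R) ∨
    ∃ P ∈ F, ¬ Stuck B F d P ∧ R = translate d.vec P ∧ ∀ t ∈ R, t.1 ∈ B.region}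

/-- Two members of the family `F` that each contain one tile from a bonded pair of tiles. -/
def Touch (G : L → L → Bool) (F : Set (Set (Tile L))) (P Q : Set (Tile L)) : Prop :=
  P ∈ F ∧ Q ∈ F ∧ ∃ s ∈ P, ∃ t ∈ Q, Bonded G s t

/-- Merging every pair of polyominoes that share a bonded pair of tiles: each polyomino is
united with all those that are linked to it by a chain of such pairs. -/
def merge (G : L → L → Bool) (F : Set (Set (Tile L))) : Set (Set (Tile L)) :=
  {R | ∃ P ∈ F, R = ⋃₀ {Q | Relation.ReflTransGen (Touch G F) P Q}}

theorem Touch.symm {G : L → L → Bool} {F : Set (Set (Tile L))} {P Q : Set (Tile L)}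
    (h : Touch G F P Q) : Touch G F Q P := by
  obtain ⟨hP, hQ, s, hs, t, ht, hb⟩ := h
  exact ⟨hQ, hP, t, ht, s, hs, hb.symm⟩

theorem reach_mem {G : L → L → Bool} {F : Set (Set (Tile L))} {P Q : Set (Tile L)}
    (hP : P ∈ F) (h : Relation.ReflTransGen (Touch G F) P Q) : Q ∈ F := by
  cases h with
  | refl => exact hP
  | tail _ h => exact h.2.1

theorem reach_symm {G : L → L → Bool} {F : Set (Set (Tile L))} {P Q : Set (Tile L)}
    (h : Relation.ReflTransGen (Touch G F) P Q) : Relation.ReflTransGen (Touch G F) Q P := by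
  induction h with
  | refl => exact .refl
  | tail _ h ih => exact .head h.symm ih

theorem translate_isPolyomino {G : L → L → Bool} {P : Set (Tile L)} (v : Loc)
    (h : IsPolyomino G P) : IsPolyomino G (translate v P) := by
  refine ⟨h.finite.image _, ?_, ?_⟩
  · rintro _ ⟨s, hs, rfl⟩ _ ⟨t, ht, rfl⟩ hst
    have : s = t := h.injOn hs ht (by simpa using hst)
    rw [this]
  · let f : (bondGraph G).induce P →g (bondGraph G).induce (translate v P) :=
      { toFun := fun t => ⟨(t.1.1 + v, t.1.2), t.1, t.2, rfl⟩
        map_rel' := by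
          rintro ⟨s, hs⟩ ⟨t, ht⟩ hst
          have hst : Bonded G s t := hst
          show Bonded G _ _
          refine ⟨?_, hst.2⟩
          have := hst.1
          unfold Adjacent at *
          simpa using this }
    refine h.connected.map f ?_
    rintro ⟨_, t, ht, rfl⟩
    exact ⟨⟨t, ht⟩, rfl⟩

/-- The motion of a step keeps polyominoes on open locations and apart from each other. -/
theorem moved_valid {G : L → L → Bool} (C : Configuration G) (d : Dir) :
    (∀ P ∈ moved C.board C.polys d, IsPolyomino G P) ∧
    (∀ P ∈ moved C.board C.polys d, ∀ t ∈ P, t.1 ∈ C.board.openLocs) ∧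
    (∀ P ∈ moved C.board C.polys d, ∀ Q ∈ moved C.board C.polys d, ∀ s ∈ P, ∀ t ∈ Q,
      s.1 = t.1 → P = Q) := by
  refine ⟨?_, ?_, ?_⟩
  · rintro R (⟨hR, -⟩ | ⟨P, hP, -, rfl, -⟩)
    · exact C.isPolyomino R hR
    · exact translate_isPolyomino _ (C.isPolyomino P hP)
  · rintro R (⟨hR, -⟩ | ⟨P, hP, hs, rfl, hb⟩) t ht
    · exact C.onOpen R hR t ht
    · refine ⟨hb t ht, ?_⟩
      obtain ⟨s, hsP, rfl⟩ := ht
      exact fun hw => hs (.wall hP hsP hw)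
  · rintro R (⟨hR, hRs⟩ | ⟨P, hP, hs, rfl, -⟩) R' (⟨hR', hRs'⟩ | ⟨P', hP', hs', rfl, -⟩)
      s hsR t htR hst
    · exact C.nonoverlap R hR R' hR' s hsR t htR hst
    · obtain ⟨t', ht', rfl⟩ := htR
      exact absurd (.push hP' ht' hRs hsR hst.symm) hs'
    · obtain ⟨s', hs'', rfl⟩ := hsR
      exact absurd (.push hP hs'' hRs' htR hst) hs
    · obtain ⟨t', ht', rfl⟩ := htR
      obtain ⟨s', hs'', rfl⟩ := hsR
      rw [C.nonoverlap P hP P' hP' s' hs'' t' ht' (by simpa using hst)]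

theorem merge_connected {G : L → L → Bool} {F : Set (Set (Tile L))} {P : Set (Tile L)}
    (hF : ∀ P ∈ F, IsPolyomino G P) (hP : P ∈ F) :
    ((bondGraph G).induce (⋃₀ {Q | Relation.ReflTransGen (Touch G F) P Q})).Connected := by
  set U := ⋃₀ {Q | Relation.ReflTransGen (Touch G F) P Q} with hU
  have hsub : ∀ Q, Relation.ReflTransGen (Touch G F) P Q → Q ⊆ U :=
    fun Q hQ t ht => ⟨Q, hQ, ht⟩
  have hin : ∀ Q (hQ : Relation.ReflTransGen (Touch G F) P Q), ∀ s (hs : s ∈ Q), ∀ t (ht : t ∈ Q),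
      ((bondGraph G).induce U).Reachable ⟨s, hsub Q hQ hs⟩ ⟨t, hsub Q hQ ht⟩ := by
    intro Q hQ s hs t ht
    exact ((hF Q (reach_mem hP hQ)).connected.preconnected ⟨s, hs⟩ ⟨t, ht⟩).map
      (SimpleGraph.induceHomOfLE (bondGraph G) (hsub Q hQ)).toHom
  obtain ⟨⟨p, hp⟩⟩ := (hF P hP).connected.nonempty
  have hall : ∀ Q (hQ : Relation.ReflTransGen (Touch G F) P Q), ∀ t (ht : t ∈ Q),
      ((bondGraph G).induce U).Reachable ⟨p, hsub P .refl hp⟩ ⟨t, hsub Q hQ ht⟩ := by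
    intro Q hQ
    induction hQ with
    | refl => exact fun t ht => hin P .refl p hp t ht
    | @tail _ R hQ hQR ih =>
      intro t ht
      obtain ⟨-, -, a, ha, b, hb, hab⟩ := id hQR
      have hR := hQ.tail hQR
      have e : ((bondGraph G).induce U).Adj ⟨a, hsub _ hQ ha⟩ ⟨b, hsub R hR hb⟩ := hab
      exact ((ih a ha).trans e.reachable).trans (hin R hR b hb t ht)
  have : Nonempty U := ⟨⟨p, hsub P .refl hp⟩⟩
  refine SimpleGraph.Connected.mk ?_
  rintro ⟨s, Q, hQ, hs⟩ ⟨t, R, hR, ht⟩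
  exact (hall Q hQ s hs).symm.trans (hall R hR t ht)

theorem Board.finite_region (B : Board) : B.region.Finite :=
  (Set.finite_Icc _ _).prod (Set.finite_Icc _ _)

/-- The configuration obtained from the moved polyominoes of `C` by merging. -/
def Configuration.moveMerge {G : L → L → Bool} (C : Configuration G) (d : Dir) :
    Configuration G where
  board := C.board
  polys := merge G (moved C.board C.polys d)
  isPolyomino := by
    obtain ⟨h1, h2, h3⟩ := moved_valid C d
    rintro _ ⟨P, hP, rfl⟩
    have hinj : Set.InjOn Prod.fst
        (⋃₀ {Q | Relation.ReflTransGen (Touch G (moved C.board C.polys d)) P Q}) := by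
      rintro s ⟨Q, hQ, hs⟩ t ⟨R, hR, ht⟩ hst
      have hQ := reach_mem hP hQ
      have hR := reach_mem hP hR
      obtain rfl := h3 Q hQ R hR s hs t ht hst
      exact (h1 Q hQ).injOn hs ht hst
    refine ⟨?_, hinj, merge_connected h1 hP⟩
    refine Set.Finite.of_finite_image (C.board.finite_region.subset ?_) hinj
    rintro _ ⟨s, ⟨Q, hQ, hs⟩, rfl⟩
    exact (h2 Q (reach_mem hP hQ) s hs).1
  onOpen := by
    rintro _ ⟨P, hP, rfl⟩ t ⟨Q, hQ, ht⟩
    exact (moved_valid C d).2.1 Q (reach_mem hP hQ) t ht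
  nonoverlap := by
    rintro _ ⟨P, hP, rfl⟩ _ ⟨P', hP', rfl⟩ s ⟨Q, hQ, hs⟩ t ⟨Q', hQ', ht⟩ hst
    obtain rfl := (moved_valid C d).2.2 Q (reach_mem hP hQ) Q' (reach_mem hP' hQ') s hs t ht hst
    have hPP' := Relation.ReflTransGen.trans hQ (reach_symm hQ')
    congr 1
    ext R
    exact ⟨fun h => (reach_symm hPP').trans h, fun h => hPP'.trans h⟩

open Classical in
/-- A step in direction `d`. If every polyomino is blocked, the configuration does not change. -/
noncomputable def Configuration.step {G : L → L → Bool} (C : Configuration G) (d : Dir) :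
    Configuration G :=
  if ∀ P ∈ C.polys, Stuck C.board C.polys d P then C else C.moveMerge d

/-- A configuration is `d`-terminal if it does not change under a step in direction `d`. -/
def Configuration.IsTerminal {G : L → L → Bool} (C : Configuration G) (d : Dir) : Prop :=
  C.step d = C

/-- `C'` is the result of a tilt of `C` in direction `d`: steps in direction `d` are applied
repeatedly until a `d`-terminal configuration is reached. -/
def Tilt {G : L → L → Bool} (d : Dir) (C C' : Configuration G) : Prop :=
  (∃ k : ℕ, (fun D : Configuration G => D.step d)^[k] C = C') ∧ C'.IsTerminal d

/-- `C` can be reconfigured in one move into `C'`. -/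
def OneMove {G : L → L → Bool} (C C' : Configuration G) : Prop := ∃ d : Dir, Tilt d C C'

/-- `C` can be reconfigured into `C'` through a sequence of tilts. -/
def Reconfigurable {G : L → L → Bool} : Configuration G → Configuration G → Prop :=
  Relation.TransGen OneMove

/-- The tilt sequence given by a list of directions takes the first configuration to the second. -/
inductive TiltSequence {G : L → L → Bool} :
    List Dir → Configuration G → Configuration G → Prop
  | nil (C : Configuration G) : TiltSequence [] C C
  | cons {d : Dir} {D : List Dir} {C C' C'' : Configuration G} :
      Tilt d C C' → TiltSequence D C' C'' → TiltSequence (d :: D) C C''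

/-- `C` is universal to a set of configurations if it can be reconfigured into each of them. -/
def IsUniversalTo {G : L → L → Bool} (C : Configuration G) (𝒞 : Set (Configuration G)) : Prop :=
  ∀ C' ∈ 𝒞, Reconfigurable C C'

/-- A pattern over a set `S` of symbols: a set of lattice locations with their symbols. -/
abbrev Pattern (S : Type) := Set (Loc × S)

/-- The `h × w` rectangular patterns over `S`: the pixels are the locations of a rectangle of
height `h` and width `w`, and each pixel carries one symbol. -/
def rectPatterns (h w : ℕ) (S : Type) : Set (Pattern S) :=
  {u | ∃ f : Loc → S, u = {q | q.1 ∈ box w h ∧ q.2 = f q.1}}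

/-- `C` strongly represents the pattern `u`, where the attachment label `enc x` stands for the
symbol `x`: it consists of a single polyomino, whose tiles are exactly the pixels of some
translation of `u`, each with the label that stands for its symbol. -/
def StronglyRepresents {S : Type} (enc : S → L) {G : L → L → Bool} (C : Configuration G)
    (u : Pattern S) : Prop :=
  ∃ v : Loc, C.polys = {(fun q : Loc × S => ((q.1 + v, enc q.2) : Tile L)) '' u}

/-- `C` is strongly universal for the set `U` of patterns. -/
def IsStronglyUniversal {S : Type} (enc : S → L) {G : L → L → Bool} (C : Configuration G)
    (U : Set (Pattern S)) : Prop :=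
  ∃ 𝒞 : Set (Configuration G),
    (∀ u ∈ U, ∃ C' ∈ 𝒞, StronglyRepresents enc C' u) ∧ IsUniversalTo C 𝒞

end Model

/-- The attachment labels used for binary patterns: one label for each of the symbols `0` and `1`,
and the label `sand`. -/
inductive Label
  | pixel (x : Fin 2)
  | sand

/-- The two pixel labels attract themselves and each other; sand attracts nothing. -/
def affinity : Label → Label → Bool
  | .pixel _, .pixel _ => true
  | _, _ => false

end TiltModel

namespace TiltModel

/-! ### Tilts as synchronous slides of arbitrary polyominoes. -/

section Slide

variable {L : Type} {G : L → L → Bool}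

/-! One fixed machine builds every pattern, row by row. Its storage holds, for each row of the
target, `2 * w` single tiles labelled alternately 0 and 1. The tiles of the current row lie on a
conveyor that brings them one at a time to a decision place, the origin of the relative coordinates.
A tilt west sends the waiting tile along a corridor, where it joins the row under construction; a
tilt north sends it up a shaft and off the board. For each pixel, of two consecutive tiles the one
with the right symbol is accepted and the other rejected. Either order costs ten tilts
(`append_pixel`).

A row of length `w` is moved by the four tilts E, S, W, S (`transfer`): it goes east over a chute,
falls onto the completed rows in the chamber and merges with them, while each stored row sinks one
level and the lowest one becomes the new conveyor load. The chute is shifted by one column against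
the resting place of the completed rows, so these can neither leave the chamber nor reach the
corridor during the north tilts of the conveyor. A row costs `10 * w + 8` tilts, and the board has
sides linear in `w` and `h`.

All tiles carry mutually attracting labels, so unwanted merging is prevented by geometry alone:
tiles are spaced by four, and their motions stay short or apart enough to leave a free line between
them. The analysis of a tilt is reduced to arithmetic by `exists_tilt_of_slide`: prescribing how far
each polyomino travels suffices, if polyominoes touch or leave the board only at the final moment.
Its versions `Shows.tilt_free`, `Shows.tilt_exit` and `Shows.tilt_merge` cover all tilts of the
machine, which then only require checking linear inequalities and residues modulo 4. -/

theorem translate_zero (P : Set (Tile L)) : translate 0 P = P := by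
  simp [translate]

theorem translate_translate (u v : Loc) (P : Set (Tile L)) :
    translate u (translate v P) = translate (v + u) P := by
  simp [translate, Set.image_image, add_assoc]

theorem mem_translate {v : Loc} {P : Set (Tile L)} {t : Tile L} (ht : t ∈ P) :
    ((t.1 + v, t.2) : Tile L) ∈ translate v P := ⟨t, ht, rfl⟩

/-- A family without bonds between distinct members is not changed by merging. -/
theorem merge_eq_self {F : Set (Set (Tile L))}
    (h : ∀ P Q, Touch G F P Q → P = Q) : merge G F = F := by
  have key : ∀ P Q, Relation.ReflTransGen (Touch G F) P Q → P = Q := by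
    intro P Q hPQ
    induction hPQ with
    | refl => rfl
    | tail _ hb ih => exact ih.trans (h _ _ hb)
  have cls : ∀ P, ⋃₀ {Q | Relation.ReflTransGen (Touch G F) P Q} = P := by
    intro P
    have : {Q | Relation.ReflTransGen (Touch G F) P Q} = {P} := by
      ext Q
      exact ⟨fun hQ => (key P Q hQ).symm, fun hQ => by
        rw [Set.mem_singleton_iff] at hQ; subst hQ; exact .refl⟩
    rw [this, Set.sUnion_singleton]
  ext R
  constructor
  · rintro ⟨P, hP, rfl⟩
    rwa [cls]
  · intro hR
    exact ⟨R, hR, (cls R).symm⟩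

/-- If the only bonds between distinct members of a family are between two of them, merging
replaces these two by their union. -/
theorem merge_eq_insert {F : Set (Set (Tile L))} {A B : Set (Tile L)} (hAB : Touch G F A B)
    (h : ∀ P Q, Touch G F P Q → P = Q ∨ (P = A ∧ Q = B) ∨ (P = B ∧ Q = A)) :
    merge G F = insert (A ∪ B) (F \ {A, B}) := by
  have key : ∀ P Q, Relation.ReflTransGen (Touch G F) P Q →
      P = Q ∨ (P ∈ ({A, B} : Set _) ∧ Q ∈ ({A, B} : Set _)) := by
    intro P Q hPQ
    induction hPQ with
    | refl => exact .inl rfl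
    | tail _ hb ih =>
      simp only [Set.mem_insert_iff, Set.mem_singleton_iff] at *
      rcases h _ _ hb with h1 | h1 | h1 <;> rcases ih with ih | ih <;> grind
  have cls : ∀ P ∈ ({A, B} : Set (Set (Tile L))),
      ⋃₀ {Q | Relation.ReflTransGen (Touch G F) P Q} = A ∪ B := by
    intro P hP
    have : {Q | Relation.ReflTransGen (Touch G F) P Q} = {A, B} := by
      ext Q
      constructor
      · intro hQ
        rcases key P Q hQ with rfl | h1
        · exact hP
        · exact h1.2
      · rintro (rfl | rfl) <;> rcases hP with rfl | rfl
        · exact .refl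
        · exact .single hAB.symm
        · exact .single hAB
        · exact .refl
    rw [this, Set.sUnion_pair]
  have cls' : ∀ P ∉ ({A, B} : Set (Set (Tile L))),
      ⋃₀ {Q | Relation.ReflTransGen (Touch G F) P Q} = P := by
    intro P hP
    have : {Q | Relation.ReflTransGen (Touch G F) P Q} = {P} := by
      ext Q
      constructor
      · intro hQ
        rcases key P Q hQ with rfl | h1
        · rfl
        · exact absurd h1.1 hP
      · rintro rfl
        exact .refl
    rw [this, Set.sUnion_singleton]
  ext R
  constructor
  · rintro ⟨P, hP, rfl⟩
    by_cases hPAB : P ∈ ({A, B} : Set (Set (Tile L)))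
    · exact .inl (cls P hPAB)
    · rw [cls' P hPAB]
      exact .inr ⟨hP, hPAB⟩
  · rintro (rfl | ⟨hR, hRAB⟩)
    · exact ⟨A, hAB.1, (cls A (.inl rfl)).symm⟩
    · exact ⟨R, hR, (cls' R hRAB).symm⟩

theorem Stuck.mem {B : Board} {F : Set (Set (Tile L))} {d : Dir} {P : Set (Tile L)}
    (h : Stuck B F d P) : P ∈ F := by
  cases h <;> assumption

/-- A polyomino that contains a blocked polyomino after merging is blocked. -/
theorem Stuck.merge {B : Board} {F : Set (Set (Tile L))} {d : Dir} {P : Set (Tile L)}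
    (h : Stuck B F d P) :
    Stuck B (merge G F) d (⋃₀ {Q | Relation.ReflTransGen (Touch G F) P Q}) := by
  induction h with
  | @wall P t hP ht hw => exact .wall ⟨P, hP, rfl⟩ ⟨P, .refl, ht⟩ hw
  | @push P Q t s hP ht hQ hs hts ih =>
    exact .push ⟨P, hP, rfl⟩ ⟨P, .refl, ht⟩ ih ⟨Q, .refl, hs⟩ hts

/-- If no two distinct polyominoes are bonded, a step moves and merges, whether or not all
polyominoes are blocked. -/
theorem step_polys (C : Configuration G) (d : Dir)
    (h : ∀ P Q, Touch G C.polys P Q → P = Q) :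
    (C.step d).board = C.board ∧ (C.step d).polys = merge G (moved C.board C.polys d) := by
  unfold Configuration.step
  split_ifs with hs
  · refine ⟨rfl, ?_⟩
    have : moved C.board C.polys d = C.polys := by
      ext R
      constructor
      · rintro (hR | ⟨P, hP, hn, -⟩)
        · exact hR.1
        · exact absurd (hs P hP) hn
      · exact fun hR => .inl ⟨hR, hs R hR⟩
    rw [this, merge_eq_self h]
  · exact ⟨rfl, rfl⟩

theorem isTerminal_of_stuck {C : Configuration G} {d : Dir}
    (h : ∀ P ∈ C.polys, Stuck C.board C.polys d P) : C.IsTerminal d := by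
  unfold Configuration.IsTerminal Configuration.step
  exact if_pos h

theorem nsmul_min_succ (k n : ℕ) (v : Loc) (hk : k < n) :
    (min k n • v) + v = min (k + 1) n • v := by
  rw [min_eq_left hk.le, min_eq_left hk, succ_nsmul]

/-- A tilt under which the polyomino `f i` moves by `n i` units, until at time `N` all the
polyominoes have stopped. Those with index in `X` leave the board at time `N`. Distinct polyominoes
are not bonded before time `N`. -/
theorem exists_tilt_of_slide {ι : Type} (C : Configuration G) (d : Dir) (f : ι → Set (Tile L))
    (I X : Set ι) (n : ι → ℕ) (N : ℕ) (hC : C.polys = f '' I) (hN : 0 < N)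
    (hn : ∀ i ∈ I, n i ≤ N)
    (hwall : ∀ i ∈ I, ∀ k ≤ n i, ∀ t ∈ f i, t.1 + k • d.vec ∉ C.board.walls)
    (hreg : ∀ i ∈ I, ∀ k ≤ n i, (i ∈ X → k < N) → ∀ t ∈ f i, t.1 + k • d.vec ∈ C.board.region)
    (hX : ∀ i ∈ I, i ∈ X → n i = N ∧ ∃ t ∈ f i, t.1 + N • d.vec ∉ C.board.region)
    (hsep : ∀ i ∈ I, ∀ j ∈ I, i ≠ j → ∀ k < N, ∀ s ∈ f i, ∀ t ∈ f j,
      ¬ Bonded G (s.1 + min k (n i) • d.vec, s.2) (t.1 + min k (n j) • d.vec, t.2))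
    (hdisj : ∀ i ∈ I, ∀ j ∈ I, i ≠ j → ∀ k ≤ N, ∀ s ∈ f i, ∀ t ∈ f j,
      s.1 + min k (n i) • d.vec ≠ t.1 + min k (n j) • d.vec)
    (hhalt : ∀ i ∈ I, i ∉ X → (∃ t ∈ f i, t.1 + n i • d.vec + d.vec ∈ C.board.walls) ∨
      ∃ j ∈ I, j ∉ X ∧ n j ≤ n i ∧ (∃ t ∈ f j, t.1 + n j • d.vec + d.vec ∈ C.board.walls) ∧
        ∃ t ∈ f i, ∃ s ∈ f j, t.1 + n i • d.vec + d.vec = s.1 + n j • d.vec) :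
    ∃ C' : Configuration G, Tilt d C C' ∧ C'.board = C.board ∧
      C'.polys = merge G ((fun i => translate (n i • d.vec) (f i)) '' (I \ X)) := by
  -- `g k i` is the position at time `k`, and `J k` holds the indices still on the board. The
  -- invariant is that before time `N` the configuration is `g k '' J k`, its stuck members being
  -- those that have used up their distance.
  set g : ℕ → ι → Set (Tile L) := fun k i => translate (min k (n i) • d.vec) (f i) with hg
  set J : ℕ → Set ι := fun k => {i ∈ I | i ∈ X → k < N} with hJ
  have stuck_of_le : ∀ k ≤ N, ∀ i ∈ J k, n i ≤ k → i ∉ X →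
      Stuck C.board (g k '' J k) d (g k i) := by
    intro k hk i hi hik hiX
    have mk : ∀ j ∈ I, j ∉ X → j ∈ J k := fun j hj hjX => ⟨hj, fun h => absurd h hjX⟩
    have wl : ∀ j ∈ I, j ∉ X → n j ≤ k →
        (∃ t ∈ f j, t.1 + n j • d.vec + d.vec ∈ C.board.walls) →
        Stuck C.board (g k '' J k) d (g k j) := by
      rintro j hj hjX hjk ⟨t, ht, hw⟩
      refine .wall ⟨j, mk j hj hjX, rfl⟩ (mem_translate ht) ?_
      simpa [min_eq_right hjk] using hw
    rcases hhalt i hi.1 hiX with h | ⟨j, hj, hjX, hji, hjw, t, ht, s, hs, hts⟩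
    · exact wl i hi.1 hiX hik h
    · refine .push ⟨i, hi, rfl⟩ (mem_translate ht) (wl j hj hjX (hji.trans hik) hjw)
        (mem_translate hs) ?_
      simpa [min_eq_right hik, min_eq_right (hji.trans hik)] using hts
  -- Induction on the cause of being stuck. A polyomino with distance left cannot face a wall by
  -- `hwall`; if it faced one that has stopped, the two would overlap at time `k + 1`, against
  -- `hdisj`.
  have le_of_stuck : ∀ k < N, ∀ P, Stuck C.board (g k '' J k) d P → ∀ i ∈ I, g k i = P →
      n i ≤ k := by
    intro k hk P hP
    induction hP with
    | @wall P t hP ht hw =>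
      rintro i hi rfl
      by_contra! hlt
      obtain ⟨s, hs, rfl⟩ := ht
      refine hwall i hi (k + 1) hlt s hs ?_
      simpa [min_eq_left hlt.le, succ_nsmul, add_assoc, -nsmul_eq_mul] using hw
    | @push P Q t s hP ht hQ hs hts ih =>
      rintro i hi rfl
      by_contra! hlt
      obtain ⟨j, hj, rfl⟩ := hQ.mem
      have hjk := ih j hj.1 rfl
      obtain ⟨t, ht, rfl⟩ := ht
      obtain ⟨s, hs, rfl⟩ := hs
      refine hdisj i hi j hj.1 (by rintro rfl; omega) (k + 1) hk t ht s hs ?_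
      rw [min_eq_right (hjk.trans k.le_succ), min_eq_left (show k + 1 ≤ n i from hlt)]
      simpa [min_eq_left hlt.le, min_eq_right hjk, succ_nsmul, add_assoc, -nsmul_eq_mul] using hts
  have moved_eq : ∀ k < N, moved C.board (g k '' J k) d = g (k + 1) '' J (k + 1) := by
    intro k hk
    have hstay : ∀ i, n i ≤ k → g (k + 1) i = g k i := by
      intro i hi
      simp only [hg, min_eq_right hi, min_eq_right (hi.trans k.le_succ)]
    have hgo : ∀ i, k < n i → g (k + 1) i = translate d.vec (g k i) := by
      intro i hi
      simp only [hg, translate_translate, nsmul_min_succ k (n i) _ hi]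
    have hXn : ∀ i ∈ I, n i ≤ k → i ∉ X := by
      intro i hi hik hiX
      have := (hX i hi hiX).1
      omega
    ext R
    constructor
    · rintro (⟨⟨i, hi, rfl⟩, hs⟩ | ⟨P, ⟨i, hi, rfl⟩, hs, rfl, hr⟩)
      · have hik := le_of_stuck k hk _ hs i hi.1 rfl
        exact ⟨i, ⟨hi.1, fun h => absurd h (hXn i hi.1 hik)⟩, hstay i hik⟩
      · have hik : k < n i := by
          by_contra! hik
          exact hs (stuck_of_le k hk.le i hi hik (hXn i hi.1 hik))
        refine ⟨i, ⟨hi.1, fun hiX => ?_⟩, hgo i hik⟩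
        -- An index of `X` is lost exactly in the step from `N - 1` to `N`.
        by_contra! hle
        obtain ⟨h1, t, ht, htr⟩ := hX i hi.1 hiX
        have hkN : k + 1 = N := by omega
        apply htr
        rw [← hgo i hik] at hr
        have := hr _ (mem_translate ht)
        simpa [hkN, h1] using this
    · rintro ⟨i, hi, rfl⟩
      have hi' : i ∈ J k := ⟨hi.1, fun h => (hi.2 h).trans' k.lt_succ_self⟩
      rcases le_or_gt (n i) k with hik | hik
      · rw [hstay i hik]
        exact .inl ⟨⟨i, hi', rfl⟩, stuck_of_le k hk.le i hi' hik (hXn i hi.1 hik)⟩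
      · refine .inr ⟨g k i, ⟨i, hi', rfl⟩, fun hs => ?_, hgo i hik, ?_⟩
        · have := le_of_stuck k hk _ hs i hi.1 rfl
          omega
        · rintro _ ⟨t, ht, rfl⟩
          have := hreg i hi.1 (k + 1) hik hi.2 t ht
          rwa [← min_eq_left (show k + 1 ≤ n i from hik)] at this
  have sep : ∀ k < N, ∀ P Q, Touch G (g k '' J k) P Q → P = Q := by
    rintro k hk P Q ⟨⟨i, hi, rfl⟩, ⟨j, hj, rfl⟩, _, ⟨s, hs, rfl⟩, _, ⟨t, ht, rfl⟩, hb⟩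
    by_contra hne
    exact hsep i hi.1 j hj.1 (fun h => hne (by rw [h])) k hk s hs t ht hb
  have run : ∀ k ≤ N, ((fun D : Configuration G => D.step d)^[k] C).board = C.board ∧
      ((fun D : Configuration G => D.step d)^[k] C).polys = merge G (g k '' J k) := by
    intro k
    induction k with
    | zero =>
      intro _
      have h0 : g 0 '' J 0 = C.polys := by
        rw [hC]
        have : J 0 = I := by ext i; exact ⟨fun h => h.1, fun h => ⟨h, fun _ => hN⟩⟩
        rw [this]
        refine Set.image_congr fun i _ => ?_
        simp [hg, translate_zero]
      refine ⟨rfl, ?_⟩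
      rw [merge_eq_self (sep 0 hN), h0]
      rfl
    | succ k ih =>
      intro hk
      obtain ⟨hb, hp⟩ := ih (by omega)
      rw [merge_eq_self (sep k hk)] at hp
      rw [Function.iterate_succ_apply']
      obtain ⟨hb', hp'⟩ := step_polys ((fun D : Configuration G => D.step d)^[k] C) d
        (by rw [hp]; exact sep k hk)
      refine ⟨hb'.trans hb, hp'.trans ?_⟩
      rw [hp, hb, moved_eq k hk]
  -- Bonds may appear at time `N`. Being stuck survives the merging, so the configuration is
  -- terminal even then.
  obtain ⟨hb, hp⟩ := run N le_rfl
  refine ⟨_, ⟨⟨N, rfl⟩, ?_⟩, hb, ?_⟩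
  · apply isTerminal_of_stuck
    rw [hp, hb]
    rintro _ ⟨_, ⟨i, hi, rfl⟩, rfl⟩
    exact (stuck_of_le N le_rfl i hi (hn i hi.1) fun h => lt_irrefl _ (hi.2 h)).merge
  · rw [hp]
    congr 1
    have : J N = I \ X := by
      ext i
      exact ⟨fun h => ⟨h.1, fun hx => lt_irrefl _ (h.2 hx)⟩,
        fun h => ⟨h.1, fun hx => absurd hx h.2⟩⟩
    rw [this]
    refine Set.image_congr fun i hi => ?_
    simp [hg, min_eq_right (hn i hi.1)]

end Slide
end TiltModel

/-! ### Slides of rectangular blocks of pixel tiles. -/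

namespace TiltModel

/-- A rectangle of pixel tiles with lower left corner `(x, y)`, width `a` and height `b`. The
symbols are given relative to the corner. -/
@[ext]
structure Block where
  x : ℤ
  y : ℤ
  a : ℤ
  b : ℤ
  lab : ℤ → ℤ → Fin 2

namespace Block

/-- The block contains the location `(X, Y)`. -/
def Has (p : Block) (X Y : ℤ) : Prop := p.x ≤ X ∧ X < p.x + p.a ∧ p.y ≤ Y ∧ Y < p.y + p.b

/-- The tiles of a block. -/
def cells (p : Block) : Set (Tile Label) :=
  {t | p.Has t.1.1 t.1.2 ∧ t.2 = .pixel (p.lab (t.1.1 - p.x) (t.1.2 - p.y))}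

/-- The block moved by `k` units in direction `d`. -/
def shift (p : Block) (d : Dir) (k : ℕ) : Block :=
  ⟨p.x + k * d.vec.1, p.y + k * d.vec.2, p.a, p.b, p.lab⟩

/-- There is a free row or column of locations between the two blocks. -/
def Gap (p q : Block) : Prop :=
  p.x + p.a < q.x ∨ q.x + q.a < p.x ∨ p.y + p.b < q.y ∨ q.y + q.b < p.y

/-- The two blocks are separated by a horizontal or vertical line. -/
def Disj (p q : Block) : Prop :=
  p.x + p.a ≤ q.x ∨ q.x + q.a ≤ p.x ∨ p.y + p.b ≤ q.y ∨ q.y + q.b ≤ p.y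

/-- A tile of the block is next to a blocked location in direction `d`. -/
def Blocked (B : Board) (d : Dir) (p : Block) : Prop :=
  ∃ X Y, p.Has X Y ∧ ((X + d.vec.1, Y + d.vec.2) : Loc) ∈ B.walls

/-- A tile of the first block is next to a tile of the second block in direction `d`. -/
def Against (d : Dir) (p q : Block) : Prop :=
  ∃ X Y, p.Has X Y ∧ q.Has (X + d.vec.1) (Y + d.vec.2)

theorem Gap.disj {p q : Block} (h : Gap p q) : Disj p q := by
  unfold Gap Disj at *; omega

theorem Gap.symm {p q : Block} (h : Gap p q) : Gap q p := by
  unfold Gap at *; omega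

theorem Disj.symm {p q : Block} (h : Disj p q) : Disj q p := by
  unfold Disj at *; omega

theorem Disj.ne {p q : Block} (h : Disj p q) {s t : Tile Label} (hs : s ∈ p.cells)
    (ht : t ∈ q.cells) : s.1 ≠ t.1 := by
  rintro he
  obtain ⟨hs, -⟩ := hs
  obtain ⟨ht, -⟩ := ht
  unfold Has Disj at *
  rw [he] at hs
  omega

/-- Adjacent locations differ by at most one in each coordinate, whereas a free row or column forces
a difference of at least two in one of them. -/
theorem Gap.not_bonded {p q : Block} (h : Gap p q) {s t : Tile Label} (hs : s ∈ p.cells)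
    (ht : t ∈ q.cells) : ¬ Bonded affinity s t := by
  rintro ⟨ha, -⟩
  obtain ⟨hs, -⟩ := hs
  obtain ⟨ht, -⟩ := ht
  unfold Has Gap Adjacent at *
  rcases abs_cases (s.1.1 - t.1.1) with h1 | h1 <;>
    rcases abs_cases (s.1.2 - t.1.2) with h2 | h2 <;> omega

theorem translate_cells (p : Block) (d : Dir) (k : ℕ) :
    translate (k • d.vec) p.cells = (p.shift d k).cells := by
  ext ⟨⟨X, Y⟩, l⟩
  constructor
  · rintro ⟨⟨⟨X', Y'⟩, l'⟩, ⟨h, hl⟩, he⟩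
    simp only [nsmul_eq_mul, Prod.ext_iff, Prod.fst_add, Prod.snd_add, Prod.fst_mul,
      Prod.snd_mul, Prod.fst_natCast, Prod.snd_natCast] at he
    obtain ⟨⟨rfl, rfl⟩, rfl⟩ := he
    refine ⟨?_, ?_⟩
    · simp only [Has, shift] at *
      omega
    · simp only [shift] at *
      rw [hl]
      congr 2 <;> ring
  · rintro ⟨h, hl⟩
    refine ⟨((X - k * d.vec.1, Y - k * d.vec.2), l), ⟨?_, ?_⟩, ?_⟩
    · simp only [Has, shift] at *
      omega
    · simp only [shift] at *
      rw [hl]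
      congr 2 <;> ring
    · simp [Prod.ext_iff]

theorem cells_nonempty {p : Block} (ha : 0 < p.a) (hb : 0 < p.b) : p.cells.Nonempty :=
  ⟨((p.x, p.y), .pixel (p.lab 0 0)), ⟨⟨le_rfl, by simpa, le_rfl, by simpa⟩, by simp⟩⟩

theorem mem_cells {p : Block} {X Y : ℤ} (h : p.Has X Y) :
    (((X, Y), .pixel (p.lab (X - p.x) (Y - p.y))) : Tile Label) ∈ p.cells := ⟨h, rfl⟩

theorem Against.bonded {d : Dir} {p q : Block} (h : Against d p q) :
    ∃ s ∈ p.cells, ∃ t ∈ q.cells, Bonded affinity s t := by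
  obtain ⟨X, Y, hp, hq⟩ := h
  refine ⟨_, mem_cells hp, _, mem_cells hq, ?_, rfl, rfl⟩
  cases d <;> simp [Adjacent, Dir.vec]

variable {ι : Type}

/-- A tilt under which the block `p i` moves by `n i` units to `p' i`, and those with index in `X`
leave the board at time `N`. Any two blocks are kept apart, except that one may be pushed at time
`N` against one that does not move. -/
theorem exists_tilt (C : Configuration affinity) (d : Dir) (p p' : ι → Block)
    (I X : Set ι) (n : ι → ℕ) (N : ℕ) (hC : C.polys = (fun i => (p i).cells) '' I) (hN : 0 < N)
    (hn : ∀ i ∈ I, n i ≤ N)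
    (hpos : ∀ i ∈ I, 0 < (p i).a ∧ 0 < (p i).b)
    (hp' : ∀ i ∈ I, p' i = (p i).shift d (n i))
    (hopen : ∀ i ∈ I, ∀ k ≤ n i, (i ∈ X → k < N) → ∀ x y, ((p i).shift d k).Has x y →
      ((x, y) : Loc) ∈ C.board.openLocs)
    (hX : ∀ i ∈ I, i ∈ X → n i = N ∧ ∀ x y, (p' i).Has x y → ((x, y) : Loc) ∉ C.board.region)
    (hsep : ∀ i ∈ I, ∀ j ∈ I, i ≠ j →
      (∀ k ≤ n i, ∀ l ≤ n j, Gap ((p i).shift d k) ((p j).shift d l)) ∨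
      (n j = 0 ∧ n i = N ∧ (∀ k < N, Gap ((p i).shift d k) (p j)) ∧ Disj (p' i) (p j)) ∨
      (n i = 0 ∧ n j = N ∧ (∀ k < N, Gap ((p j).shift d k) (p i)) ∧ Disj (p' j) (p i)))
    (hhalt : ∀ i ∈ I, i ∉ X → Blocked C.board d (p' i) ∨
      ∃ j ∈ I, j ∉ X ∧ n j ≤ n i ∧ Blocked C.board d (p' j) ∧ Against d (p' i) (p' j)) :
    ∃ C' : Configuration affinity, Tilt d C C' ∧ C'.board = C.board ∧
      C'.polys = merge affinity ((fun i => (p' i).cells) '' (I \ X)) := by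
  have shift0 : ∀ q : Block, q.shift d 0 = q := fun q => by simp [shift]
  have mem : ∀ i k, ∀ t ∈ (p i).cells,
      ((t.1 + k • d.vec, t.2) : Tile Label) ∈ ((p i).shift d k).cells := by
    intro i k t ht
    rw [← translate_cells]
    exact mem_translate ht
  have blk : ∀ i ∈ I, Blocked C.board d (p' i) →
      ∃ t ∈ (p i).cells, t.1 + n i • d.vec + d.vec ∈ C.board.walls := by
    rintro i hi ⟨x, y, hxy, hw⟩
    have := mem_cells hxy
    rw [hp' i hi, ← translate_cells] at this
    obtain ⟨t, ht, he⟩ := this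
    refine ⟨t, ht, ?_⟩
    rw [show t.1 + n i • d.vec = (x, y) from (Prod.ext_iff.1 he).1]
    exact hw
  refine (exists_tilt_of_slide C d (fun i => (p i).cells) I X n N hC hN hn
    ?_ ?_ ?_ ?_ ?_ ?_).imp ?_
  · intro i hi k hk t ht
    have hm := mem i k t ht
    by_cases hkX : i ∈ X ∧ k = N
    · obtain ⟨h, rfl⟩ := hkX
      obtain ⟨h1, h2⟩ := hX i hi h
      rw [hp' i hi, h1] at h2
      exact fun hw => h2 _ _ hm.1 (C.board.walls_subset hw)
    · exact (hopen i hi k hk (fun h => lt_of_le_of_ne (hk.trans (hn i hi)) fun he => hkX ⟨h, he⟩)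
        _ _ hm.1).2
  · intro i hi k hk hkX t ht
    exact (hopen i hi k hk hkX _ _ (mem i k t ht).1).1
  · intro i hi hiX
    obtain ⟨h1, h2⟩ := hX i hi hiX
    refine ⟨h1, ?_⟩
    obtain ⟨t, ht⟩ := cells_nonempty (hpos i hi).1 (hpos i hi).2
    refine ⟨t, ht, h2 _ _ ?_⟩
    rw [hp' i hi, h1]
    exact (mem i N t ht).1
  · intro i hi j hj hij k hk s hs t ht
    have hs' := mem i (min k (n i)) s hs
    have ht' := mem j (min k (n j)) t ht
    refine Gap.not_bonded ?_ hs' ht'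
    rcases hsep i hi j hj hij with h | ⟨h1, h2, h3, -⟩ | ⟨h1, h2, h3, -⟩
    · exact h _ (min_le_right _ _) _ (min_le_right _ _)
    · rw [h1, h2, min_eq_left hk.le, Nat.min_zero, shift0]
      exact h3 k hk
    · rw [h1, h2, min_eq_left hk.le, Nat.min_zero, shift0]
      exact (h3 k hk).symm
  · intro i hi j hj hij k hk s hs t ht
    refine Disj.ne ?_ (mem i (min k (n i)) s hs) (mem j (min k (n j)) t ht)
    rcases hsep i hi j hj hij with h | ⟨h1, h2, h3, h4⟩ | ⟨h1, h2, h3, h4⟩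
    · exact (h _ (min_le_right _ _) _ (min_le_right _ _)).disj
    · rw [h1, h2, min_eq_left hk, Nat.min_zero, shift0]
      rcases hk.lt_or_eq with hk | rfl
      · exact (h3 k hk).disj
      · rwa [hp' i hi, h2] at h4
    · rw [h1, h2, min_eq_left hk, Nat.min_zero, shift0]
      rcases hk.lt_or_eq with hk | rfl
      · exact (h3 k hk).disj.symm
      · rw [hp' j hj, h2] at h4
        exact h4.symm
  · intro i hi hiX
    rcases hhalt i hi hiX with h | ⟨j, hj, hjX, hji, hb, x, y, hx, hy⟩
    · exact .inl (blk i hi h)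
    · refine .inr ⟨j, hj, hjX, hji, blk j hj hb, ?_⟩
      have h1 := mem_cells hx
      have h2 := mem_cells hy
      rw [hp' i hi, ← translate_cells] at h1
      rw [hp' j hj, ← translate_cells] at h2
      obtain ⟨t, ht, he⟩ := h1
      obtain ⟨s, hs, he'⟩ := h2
      refine ⟨t, ht, s, hs, ?_⟩
      rw [show t.1 + n i • d.vec = (x, y) from (Prod.ext_iff.1 he).1,
        show s.1 + n j • d.vec = (x + d.vec.1, y + d.vec.2) from (Prod.ext_iff.1 he').1]
      rfl
  · rintro C' ⟨h1, h2, h3⟩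
    refine ⟨h1, h2, ?_⟩
    rw [h3]
    congr 1
    refine Set.image_congr fun i hi => ?_
    rw [translate_cells, hp' i hi.1]

/-- A tilt without any merging. -/
theorem exists_tilt_free (C : Configuration affinity) (d : Dir) (p p' : ι → Block)
    (I X : Set ι) (n : ι → ℕ) (N : ℕ) (hC : C.polys = (fun i => (p i).cells) '' I) (hN : 0 < N)
    (hn : ∀ i ∈ I, n i ≤ N)
    (hpos : ∀ i ∈ I, 0 < (p i).a ∧ 0 < (p i).b)
    (hp' : ∀ i ∈ I, p' i = (p i).shift d (n i))
    (hopen : ∀ i ∈ I, ∀ k ≤ n i, (i ∈ X → k < N) → ∀ x y, ((p i).shift d k).Has x y →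
      ((x, y) : Loc) ∈ C.board.openLocs)
    (hX : ∀ i ∈ I, i ∈ X → n i = N ∧ ∀ x y, (p' i).Has x y → ((x, y) : Loc) ∉ C.board.region)
    (hsep : ∀ i ∈ I, ∀ j ∈ I, i ≠ j →
      ∀ k ≤ n i, ∀ l ≤ n j, Gap ((p i).shift d k) ((p j).shift d l))
    (hhalt : ∀ i ∈ I, i ∉ X → Blocked C.board d (p' i)) :
    ∃ C' : Configuration affinity, Tilt d C C' ∧ C'.board = C.board ∧
      C'.polys = (fun i => (p' i).cells) '' (I \ X) := by
  obtain ⟨C', h1, h2, h3⟩ := exists_tilt C d p p' I X n N hC hN hn hpos hp' hopen hX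
    (fun i hi j hj hij => .inl (hsep i hi j hj hij)) (fun i hi hiX => .inl (hhalt i hi hiX))
  refine ⟨C', h1, h2, h3.trans (merge_eq_self ?_)⟩
  rintro P Q ⟨⟨i, hi, rfl⟩, ⟨j, hj, rfl⟩, s, hs, t, ht, hb⟩
  by_contra hne
  have hij : i ≠ j := fun h => hne (by rw [h])
  have := hsep i hi.1 j hj.1 hij _ le_rfl _ le_rfl
  rw [← hp' i hi.1, ← hp' j hj.1] at this
  exact this.not_bonded hs ht hb

/-- A tilt that pushes the block with index `u` against the block with index `v`, which does not
move, and merges the two. -/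
theorem exists_tilt_merge (C : Configuration affinity) (d : Dir) (p p' : ι → Block)
    (I : Set ι) (n : ι → ℕ) {u v : ι} (hu : u ∈ I) (hv : v ∈ I)
    (hC : C.polys = (fun i => (p i).cells) '' I) (hN : 0 < n u)
    (hn : ∀ i ∈ I, n i ≤ n u)
    (hpos : ∀ i ∈ I, 0 < (p i).a ∧ 0 < (p i).b)
    (hp' : ∀ i ∈ I, p' i = (p i).shift d (n i))
    (hopen : ∀ i ∈ I, ∀ k ≤ n i, ∀ x y, ((p i).shift d k).Has x y →
      ((x, y) : Loc) ∈ C.board.openLocs)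
    (hsep : ∀ i ∈ I, ∀ j ∈ I, i ≠ j → ¬ (i = u ∧ j = v) → ¬ (i = v ∧ j = u) →
      ∀ k ≤ n i, ∀ l ≤ n j, Gap ((p i).shift d k) ((p j).shift d l))
    (hv0 : n v = 0) (hgap : ∀ k < n u, Gap ((p u).shift d k) (p v)) (hdisj : Disj (p' u) (p v))
    (hhalt : ∀ i ∈ I, i ≠ u → Blocked C.board d (p' i)) (huv : Against d (p' u) (p' v)) :
    ∃ C' : Configuration affinity, Tilt d C C' ∧ C'.board = C.board ∧
      C'.polys = insert ((p' u).cells ∪ (p' v).cells)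
        ((fun i => (p' i).cells) '' (I \ {u, v})) := by
  have huv_ne : u ≠ v := by rintro rfl; omega
  have hpv : p' v = p v := by rw [hp' v hv, hv0]; simp [shift]
  -- The final time is the travel time of `u`, the longest one, so that the contact with `v` occurs
  -- only at the end.
  refine (exists_tilt C d p p' I ∅ n (n u) hC hN hn hpos hp'
    (fun i hi k hk _ => hopen i hi k hk) (fun i _ h => absurd h (Set.notMem_empty i)) ?_ ?_).imp ?_
  · intro i hi j hj hij
    by_cases h1 : i = u ∧ j = v
    · obtain ⟨rfl, rfl⟩ := h1
      exact .inr (.inl ⟨hv0, rfl, hgap, hdisj⟩)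
    by_cases h2 : i = v ∧ j = u
    · obtain ⟨rfl, rfl⟩ := h2
      exact .inr (.inr ⟨hv0, rfl, hgap, hdisj⟩)
    · exact .inl (hsep i hi j hj hij h1 h2)
  · intro i hi _
    by_cases h : i = u
    · subst h
      exact .inr ⟨v, hv, Set.notMem_empty _, by omega, hhalt v hv huv_ne.symm, huv⟩
    · exact .inl (hhalt i hi h)
  · rintro C' ⟨h1, h2, h3⟩
    have hne : ∀ i ∈ I, ∀ j ∈ I, i ≠ j → (p' i).cells ≠ (p' j).cells := by
      intro i hi j hj hij he
      obtain ⟨t, ht⟩ : (p' i).cells.Nonempty := by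
        refine cells_nonempty ?_ ?_ <;> rw [hp' i hi]
        exacts [(hpos i hi).1, (hpos i hi).2]
      have ht' := he ▸ ht
      refine Disj.ne ?_ ht ht' rfl
      by_cases h1 : i = u ∧ j = v
      · obtain ⟨rfl, rfl⟩ := h1
        rwa [hpv]
      by_cases h2 : i = v ∧ j = u
      · obtain ⟨rfl, rfl⟩ := h2
        rw [hpv]
        exact hdisj.symm
      · have := (hsep i hi j hj hij h1 h2 _ le_rfl _ le_rfl).disj
        rwa [← hp' i hi, ← hp' j hj] at this
    refine ⟨h1, h2, ?_⟩
    rw [h3, Set.sdiff_empty, merge_eq_insert (A := (p' u).cells) (B := (p' v).cells)]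
    · congr 1
      ext R
      constructor
      · rintro ⟨⟨i, hi, rfl⟩, h⟩
        refine ⟨i, ⟨hi, ?_⟩, rfl⟩
        rintro (rfl | rfl)
        · exact h (.inl rfl)
        · exact h (.inr rfl)
      · rintro ⟨i, ⟨hi, h⟩, rfl⟩
        refine ⟨⟨i, hi, rfl⟩, ?_⟩
        rintro (he | he)
        · exact hne i hi u hu (fun e => h (.inl e)) he
        · exact hne i hi v hv (fun e => h (.inr e)) he
    · exact ⟨⟨u, hu, rfl⟩, ⟨v, hv, rfl⟩, huv.bonded⟩
    · rintro P Q ⟨⟨i, hi, rfl⟩, ⟨j, hj, rfl⟩, s, hs, t, ht, hb⟩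
      by_contra! hcon
      obtain ⟨h1, h2, h3⟩ := hcon
      have := hsep i hi j hj (fun e => h1 (by rw [e])) (fun e => h2 (by rw [e.1]) (by rw [e.2]))
        (fun e => h3 (by rw [e.1]) (by rw [e.2])) _ le_rfl _ le_rfl
      rw [← hp' i hi, ← hp' j hj] at this
      exact this.not_bonded hs ht hb

end Block
end TiltModel

/-! ### The board of the machine and its three kinds of tilt. -/

namespace TiltModel
namespace Machine

open Block

/-- The open locations of the machine, relative to the place where the tiles are accepted or
rejected. -/
inductive IsOpen (h w X Y : ℤ) : Prop
  | corridor (hY : Y = 0) (h1 : -w - 1 ≤ X) (h2 : X ≤ w + 1)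
  | chute (hY : Y = -1) (h1 : 2 ≤ X) (h2 : X ≤ w + 1)
  | chamber (h1 : 1 ≤ X) (h2 : X ≤ w + 1) (h3 : -h - 1 ≤ Y) (h4 : Y ≤ -2)
  | shaft (hX : X = 0) (hY : 0 ≤ Y)
  -- The obstacles work by residues of `X` modulo 4. West tilts carry a tile from residue 0 to 2 at
  -- height 2, and from 2 to the next 0 at height 4; row 3 joins these heights in both residues.
  -- Stored tiles rest at heights 2 modulo 4 in columns of residue 0. There they can rise by two and
  -- come back, but they sink to a lower level only in columns of residue 1, that is, after a tilt
  -- east.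
  | conveyor (h1 : 1 ≤ X) (h2 : X ≤ 8 * w + 1) (h3 : 2 ≤ Y) (h4 : Y = 2 → X % 4 ≠ 1)
      (h5 : Y = 3 → X % 4 = 0 ∨ X % 4 = 2) (h6 : Y = 4 → X % 4 ≠ 3)
      (h7 : 5 ≤ Y → Y % 2 = 0 → X % 4 = 0 ∨ X % 4 = 1) (h8 : 5 ≤ Y → Y % 4 = 1 → X % 4 = 1)
      (h9 : 5 ≤ Y → Y % 4 = 3 → X % 4 = 0)

/-- The board of the machine. -/
def board (h w : ℕ) : Board where
  width := 9 * w + 5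
  height := 5 * h + 4
  walls := {p | p ∈ box (9 * w + 5) (5 * h + 4) ∧ ¬ IsOpen h w (p.1 - (w + 3)) (p.2 - (h + 3))}
  walls_subset := fun _ hp => hp.1

theorem mem_box {m n : ℕ} {x y : ℤ} :
    ((x, y) : Loc) ∈ box m n ↔ (1 ≤ x ∧ x ≤ m) ∧ 1 ≤ y ∧ y ≤ n := by
  simp only [box, Set.mem_prod, Set.mem_Icc]

variable {h w : ℕ}

theorem mem_openLocs {x y : ℤ} (hy : y - (h + 3) ≤ 4 * h + 1)
    (ho : IsOpen h w (x - (w + 3)) (y - (h + 3))) : ((x, y) : Loc) ∈ (board h w).openLocs := by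
  refine ⟨mem_box.2 ?_, fun hw => hw.2 ho⟩
  simp only [board]
  push_cast
  rcases ho <;> omega

/-- The polyominoes of the machine: single tiles, the row under construction, and the completed
rows. -/
inductive Idx
  | tile (i j : ℕ)
  | row
  | rect

/-- The configuration is on the board of the machine and consists of the given blocks. -/
def Shows (h w : ℕ) (C : Configuration affinity) (I : Idx → Prop) (p : Idx → Block) : Prop :=
  C.board = board h w ∧ C.polys = (fun i => (p i).cells) '' {i | I i}

/-- Some tile of the block has a blocked location next to it in direction `d`. -/
def Stops (h w : ℕ) (d : Dir) (p : Block) : Prop :=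
  ∃ X Y : ℤ, p.Has (X + (w + 3)) (Y + (h + 3)) ∧ (-w - 2 ≤ X + d.vec.1 ∧ X + d.vec.1 ≤ 8 * w + 2) ∧
    (-h - 2 ≤ Y + d.vec.2 ∧ Y + d.vec.2 ≤ 4 * h + 1) ∧ ¬ IsOpen h w (X + d.vec.1) (Y + d.vec.2)

theorem Stops.blocked {d : Dir} {p : Block} (hp : Stops h w d p) : Blocked (board h w) d p := by
  obtain ⟨X, Y, hXY, h1, h2, ho⟩ := hp
  refine ⟨_, _, hXY, mem_box.2 ?_, ?_⟩
  · push_cast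
    omega
  · convert ho using 2 <;> ring

/-- The `k`-th translate of the block lies on open locations. -/
def Fits (h w : ℕ) (d : Dir) (p : Block) (k : ℕ) : Prop :=
  ∀ X Y : ℤ, (p.shift d k).Has (X + (w + 3)) (Y + (h + 3)) → Y ≤ 4 * h + 1 ∧ IsOpen h w X Y

theorem Fits.mem_openLocs {d : Dir} {p : Block} {k : ℕ} (hp : Fits h w d p k) {x y : ℤ}
    (hxy : (p.shift d k).Has x y) : ((x, y) : Loc) ∈ (board h w).openLocs := by
  have := hp (x - (w + 3)) (y - (h + 3)) (by simpa using hxy)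
  exact Machine.mem_openLocs this.1 this.2

/-- Indices are only names. This serves when a tile becomes a row of length one, or a row becomes
the first completed row, without any merging. -/
theorem Shows.relabel {C : Configuration affinity} {I I' : Idx → Prop} {p p' : Idx → Block}
    (hC : Shows h w C I p) (u v : Idx) (hu : I u) (hI : ∀ i, I' i ↔ i = v ∨ (I i ∧ i ≠ u))
    (hp : ∀ i, I i → i ≠ u → (p' i).cells = (p i).cells) (hv : (p' v).cells = (p u).cells) :
    Shows h w C I' p' := by
  refine ⟨hC.1, hC.2.trans ?_⟩
  ext R
  constructor
  · rintro ⟨i, hi, rfl⟩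
    by_cases hiu : i = u
    · subst hiu
      exact ⟨v, (hI v).2 (.inl rfl), hv⟩
    · exact ⟨i, (hI i).2 (.inr ⟨hi, hiu⟩), hp i hi hiu⟩
  · rintro ⟨i, hi, rfl⟩
    rcases (hI i).1 hi with rfl | ⟨hi, hiu⟩
    · exact ⟨u, hu, hv.symm⟩
    · exact ⟨i, hi, (hp i hi hiu).symm⟩

theorem Shows.congr {C : Configuration affinity} {I I' : Idx → Prop} {p p' : Idx → Block}
    (hC : Shows h w C I p) (hI : ∀ i, I' i ↔ I i) (hp : ∀ i, I i → p' i = p i) :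
    Shows h w C I' p' := by
  obtain rfl : I' = I := funext fun i => propext (hI i)
  exact ⟨hC.1, hC.2.trans (Set.image_congr fun i hi => by rw [hp i hi])⟩

theorem Shows.tilt_free {C : Configuration affinity} {I : Idx → Prop} {p : Idx → Block}
    (hC : Shows h w C I p) (d : Dir) (p' : Idx → Block) (n : Idx → ℕ) (N : ℕ)
    (hn : ∀ i, I i → n i ≤ N) (hpos : ∀ i, I i → 0 < (p i).a ∧ 0 < (p i).b)
    (hp' : ∀ i, I i → p' i = (p i).shift d (n i))
    (hfit : ∀ i, I i → ∀ k ≤ n i, Fits h w d (p i) k)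
    (hsep : ∀ i, I i → ∀ j, I j → i ≠ j →
      ∀ k ≤ n i, ∀ l ≤ n j, Gap ((p i).shift d k) ((p j).shift d l))
    (hhalt : ∀ i, I i → Stops h w d (p' i)) :
    ∃ C', Tilt d C C' ∧ Shows h w C' I p' := by
  obtain ⟨hB, hC⟩ := hC
  -- The successor makes the duration positive; surplus steps do nothing.
  refine (exists_tilt_free C d p p' {i | I i} ∅ n (N + 1) hC (by omega)
    (fun i hi => (hn i hi).trans N.le_succ) hpos hp' ?_ ?_ hsep ?_).imp ?_
  · intro i hi k hk _ x y hxy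
    rw [hB]
    exact (hfit i hi k hk).mem_openLocs hxy
  · exact fun i _ h => absurd h (Set.notMem_empty i)
  · intro i hi _
    rw [hB]
    exact (hhalt i hi).blocked
  · rintro C' ⟨h1, h2, h3⟩
    exact ⟨h1, h2.trans hB, h3.trans (by rw [Set.sdiff_empty])⟩

/-- The leaving polyomino has to travel longest, because removal is only handled at the final time.
It leaves across the north side. -/
theorem Shows.tilt_exit {C : Configuration affinity} {I I' : Idx → Prop} {p : Idx → Block}
    (hC : Shows h w C I p) (d : Dir) (p' : Idx → Block) (n : Idx → ℕ) (u : Idx)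
    (hN : 0 < n u) (hI : ∀ i, I' i ↔ I i ∧ i ≠ u)
    (hn : ∀ i, I i → n i ≤ n u) (hpos : ∀ i, I i → 0 < (p i).a ∧ 0 < (p i).b)
    (hp' : ∀ i, I i → p' i = (p i).shift d (n i))
    (hfit : ∀ i, I i → ∀ k ≤ n i, (i = u → k < n u) → Fits h w d (p i) k)
    (hexit : ∀ x y, (p' u).Has x y → ¬ y ≤ 5 * h + 4)
    (hsep : ∀ i, I i → ∀ j, I j → i ≠ j →
      ∀ k ≤ n i, ∀ l ≤ n j, Gap ((p i).shift d k) ((p j).shift d l))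
    (hhalt : ∀ i, I' i → Stops h w d (p' i)) :
    ∃ C', Tilt d C C' ∧ Shows h w C' I' p' := by
  obtain ⟨hB, hC⟩ := hC
  refine (exists_tilt_free C d p p' {i | I i} {u} n (n u) hC hN
    hn hpos hp' ?_ ?_ hsep ?_).imp ?_
  · intro i hi k hk hku x y hxy
    rw [hB]
    exact (hfit i hi k hk hku).mem_openLocs hxy
  · rintro i _ rfl
    refine ⟨rfl, fun x y hxy hr => hexit x y hxy ?_⟩
    rw [hB] at hr
    have := (mem_box.1 hr).2.2
    simp only [board] at this
    push_cast at this
    exact this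
  · intro i hi hiu
    rw [hB]
    exact (hhalt i ((hI i).2 ⟨hi, hiu⟩)).blocked
  · rintro C' ⟨h1, h2, h3⟩
    refine ⟨h1, h2.trans hB, h3.trans ?_⟩
    congr 1
    ext i
    exact (hI i).symm

/-- After the contact the index `v` names the union, whose block is given by `p''`, and `u`
disappears. -/
theorem Shows.tilt_merge {C : Configuration affinity} {I I' : Idx → Prop} {p : Idx → Block}
    (hC : Shows h w C I p) (d : Dir) (p' p'' : Idx → Block) (n : Idx → ℕ) (u v : Idx)
    (hu : I u) (hv : I v) (hN : 0 < n u)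
    (hn : ∀ i, I i → n i ≤ n u) (hpos : ∀ i, I i → 0 < (p i).a ∧ 0 < (p i).b)
    (hp' : ∀ i, I i → p' i = (p i).shift d (n i))
    (hfit : ∀ i, I i → ∀ k ≤ n i, Fits h w d (p i) k)
    (hsep : ∀ i, I i → ∀ j, I j → i ≠ j → ¬ (i = u ∧ j = v) → ¬ (i = v ∧ j = u) →
      ∀ k ≤ n i, ∀ l ≤ n j, Gap ((p i).shift d k) ((p j).shift d l))
    (hv0 : n v = 0) (hgap : ∀ k < n u, Gap ((p u).shift d k) (p v)) (hdisj : Disj (p' u) (p v))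
    (hhalt : ∀ i, I i → i ≠ u → Stops h w d (p' i)) (huv : Against d (p' u) (p' v))
    (hI : ∀ i, I' i ↔ I i ∧ i ≠ u) (hp'' : ∀ i, I i → i ≠ u → i ≠ v → p'' i = p' i)
    (hun : (p'' v).cells = (p' u).cells ∪ (p' v).cells) :
    ∃ C', Tilt d C C' ∧ Shows h w C' I' p'' := by
  obtain ⟨hB, hC⟩ := hC
  refine (exists_tilt_merge C d p p' {i | I i} n hu hv hC hN hn hpos hp' ?_ hsep hv0 hgap hdisj
    ?_ huv).imp ?_
  · intro i hi k hk x y hxy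
    rw [hB]
    exact (hfit i hi k hk).mem_openLocs hxy
  · intro i hi hiu
    rw [hB]
    exact (hhalt i hi hiu).blocked
  · rintro C' ⟨h1, h2, h3⟩
    refine ⟨h1, h2.trans hB, h3.trans ?_⟩
    have hvu : v ≠ u := by rintro rfl; omega
    ext R
    constructor
    · rintro (rfl | ⟨i, ⟨hi, hne⟩, rfl⟩)
      · exact ⟨v, (hI v).2 ⟨hv, hvu⟩, hun⟩
      · simp only [Set.mem_insert_iff, Set.mem_singleton_iff, not_or] at hne
        exact ⟨i, (hI i).2 ⟨hi, hne.1⟩, by simp only [hp'' i hi hne.1 hne.2]⟩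
    · rintro ⟨i, hi, rfl⟩
      obtain ⟨hi, hiu⟩ := (hI i).1 hi
      by_cases hiv : i = v
      · subst hiv
        exact .inl hun
      · refine .inr ⟨i, ⟨hi, ?_⟩, by simp only [hp'' i hi hiu hiv]⟩
        simp [hiu, hiv]


/-! ### Positions of the tiles, and the tilts that move the conveyor and the storage. -/

open Block

/-- The symbol of the tiles in column `j` of the storage. -/
def sym (j : ℕ) : Fin 2 := if j % 2 = 0 then 0 else 1

/-- The blocks of the machine for the target pattern `g`, when `r` rows are complete: tiles, the row
under construction, of length `L`, and the completed rows. Coordinates are relative to the place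
where the tiles are accepted or rejected. -/
def blocks (h w : ℕ) (g : ℤ → ℤ → Fin 2) (r L : ℕ) (tx ty : ℕ → ℕ → ℤ) (rx ry ex ey : ℤ) :
    Idx → Block
  | .tile i j => ⟨tx i j + (w + 3), ty i j + (h + 3), 1, 1, fun _ _ => sym j⟩
  | .row => ⟨rx + (w + 3), ry + (h + 3), L, 1, fun X _ => g X r⟩
  | .rect => ⟨ex + (w + 3), ey + (h + 3), w, r, g⟩

/-- The polyominoes that are present when `r` rows are complete, `s` tiles of the next row have been
used, and the row under construction has length `L`. -/
def Present (h w r s L : ℕ) : Idx → Prop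
  | .tile i j => i < h ∧ j < 2 * w ∧ (i = r ∧ s ≤ j ∨ r < i)
  | .row => 0 < L
  | .rect => 0 < r

/-- Horizontal positions of the tiles: on the conveyor after `q` advances, shifted by `a`, and
in the storage, shifted by `b`. -/
def posX (r q : ℕ) (a b : ℤ) (i j : ℕ) : ℤ :=
  if i = r then 4 * (j + 1 - q) + a else 4 * (j + 1) + b

/-- Vertical positions of the tiles: `a` on the conveyor, and shifted by `b` in the storage. -/
def posY (r : ℕ) (a : ℕ → ℤ) (b : ℤ) (i j : ℕ) : ℤ :=
  if i = r then a j else 6 + 4 * (i - r - 1) + b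

/-- Distances: `a` for tiles on the conveyor, `b` for tiles in the storage, `c` for the row under
construction and `e` for the completed rows. -/
def dist (r : ℕ) (a : ℕ → ℕ) (b c e : ℕ) : Idx → ℕ
  | .tile i j => if i = r then a j else b
  | .row => c
  | .rect => e

variable {h w : ℕ} {g : ℤ → ℤ → Fin 2}

theorem stops_of {d : Dir} {p : Block} (X Y : ℤ) (hp : p.Has (X + (w + 3)) (Y + (h + 3)))
    (hX : -w - 2 ≤ X + d.vec.1 ∧ X + d.vec.1 ≤ 8 * w + 2)
    (hY : -h - 2 ≤ Y + d.vec.2 ∧ Y + d.vec.2 ≤ 4 * h + 1)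
    (ho : ¬ IsOpen h w (X + d.vec.1) (Y + d.vec.2)) : Stops h w d p := ⟨X, Y, hp, hX, hY, ho⟩

/-- When no tile is ready to be accepted, a tilt to the west only moves the conveyor. -/
theorem tilt_west_idle {C : Configuration affinity} {r q L : ℕ} (hw : 0 < w) (hr : r < h)
    (hL : L ≤ w)
    (hC : Shows h w C (Present h w r q L) (blocks h w g r L (posX r q 0 0)
      (posY r (fun j => if j + 1 = q then 0 else 2) 0) (-w - 1) 0 1 (-h - 1))) :
    ∃ C', Tilt .W C C' ∧ Shows h w C' (Present h w r q L)
      (blocks h w g r L (posX r q (-2) 0)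
      (posY r (fun _ => 2) 0) (-w - 1) 0 1 (-h - 1)) := by
  refine hC.tilt_free _ _ (dist r (fun _ => 2) 0 0 0) (2) ?_ ?_ ?_ ?_ ?_ ?_
  · rintro (⟨i, j⟩ | _ | _) hi <;> simp only [Present, dist] at * <;> (try split_ifs at *) <;> omega
  · rintro (⟨i, j⟩ | _ | _) hi <;> simp only [Present, blocks] at * <;> omega
  · rintro (⟨i, j⟩ | _ | _) hi <;>
      simp only [Present, dist, blocks, shift, posX, posY, Dir.vec, Block.mk.injEq, and_true] at *
      <;> (try split_ifs at *) <;> omega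
  · rintro (⟨i, j⟩ | _ | _) hi k hk X Y hXY <;>
      simp only [Present, dist, blocks, shift, posX, posY, Dir.vec, Has] at * <;>
      refine ⟨by (try split_ifs at *) <;> omega, ?_⟩
    · apply IsOpen.conveyor <;> (try split_ifs at *) <;> omega
    · apply IsOpen.corridor <;> omega
    · apply IsOpen.chamber <;> omega
  · rintro (⟨i, j⟩ | _ | _) hi (⟨i', j'⟩ | _ | _) hj hij k hk l hl <;>
      simp only [Present, dist, blocks, shift, posX, posY, Dir.vec, Gap, ne_eq, Idx.tile.injEq,
        not_true_eq_false] at * <;>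
      (try split_ifs at *) <;> omega
  · rintro (⟨i, j⟩ | _ | _) hi <;> simp only [Present] at hi
    · refine stops_of (posX r q (-2) 0 i j)
        (posY r (fun _ => 2) 0 i j) ?_ ?_ ?_ ?_ <;>
        simp only [blocks, posX, posY, Dir.vec, Has] at * <;>
        (try split_ifs at *) <;> first | omega | (rintro (_ | _ | _ | _ | _) <;> omega)
    · refine stops_of (-w - 1) 0 ?_ ?_ ?_ ?_ <;> simp only [blocks, Dir.vec, Has] at * <;>
        first | omega | (rintro (_ | _ | _ | _ | _) <;> omega)
    · refine stops_of 1 (-h - 1) ?_ ?_ ?_ ?_ <;> simp only [blocks, Dir.vec, Has] at * <;>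
        first | omega | (rintro (_ | _ | _ | _ | _) <;> omega)

/-- The second tilt of an advance of the conveyor. -/
theorem tilt_north_conveyor {C : Configuration affinity} {r q L : ℕ} (hw : 0 < w) (hr : r < h)
    (hL : L ≤ w)
    (hC : Shows h w C (Present h w r q L) (blocks h w g r L (posX r q (-2) 0)
      (posY r (fun _ => 2) 0) (-w - 1) 0 1 (-h - 1))) :
    ∃ C', Tilt .N C C' ∧ Shows h w C' (Present h w r q L)
      (blocks h w g r L (posX r q (-2) 0)
      (posY r (fun _ => 4) 2) (-w - 1) 0 1 (-r - 1)) := by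
  -- The completed rows rise to the ceiling of the chamber, where their column `X = 1` is stopped
  -- since the chute begins at `X = 2`.
  refine hC.tilt_free _ _ (dist r (fun _ => 2) 2 0 (h - r)) (h + 2) ?_ ?_ ?_ ?_ ?_ ?_
  · rintro (⟨i, j⟩ | _ | _) hi <;> simp only [Present, dist] at * <;> (try split_ifs at *) <;> omega
  · rintro (⟨i, j⟩ | _ | _) hi <;> simp only [Present, blocks] at * <;> omega
  · rintro (⟨i, j⟩ | _ | _) hi <;>
      simp only [Present, dist, blocks, shift, posX, posY, Dir.vec, Block.mk.injEq, and_true] at *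
      <;> (try split_ifs at *) <;> omega
  · rintro (⟨i, j⟩ | _ | _) hi k hk X Y hXY <;>
      simp only [Present, dist, blocks, shift, posX, posY, Dir.vec, Has] at * <;>
      refine ⟨by (try split_ifs at *) <;> omega, ?_⟩
    · apply IsOpen.conveyor <;> (try split_ifs at *) <;> omega
    · apply IsOpen.corridor <;> omega
    · apply IsOpen.chamber <;> omega
  · rintro (⟨i, j⟩ | _ | _) hi (⟨i', j'⟩ | _ | _) hj hij k hk l hl <;>
      simp only [Present, dist, blocks, shift, posX, posY, Dir.vec, Gap, ne_eq, Idx.tile.injEq,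
        not_true_eq_false] at * <;>
      (try split_ifs at *) <;> omega
  · rintro (⟨i, j⟩ | _ | _) hi <;> simp only [Present] at hi
    · refine stops_of (posX r q (-2) 0 i j)
        (posY r (fun _ => 4) 2 i j) ?_ ?_ ?_ ?_ <;>
        simp only [blocks, posX, posY, Dir.vec, Has] at * <;>
        (try split_ifs at *) <;> first | omega | (rintro (_ | _ | _ | _ | _) <;> omega)
    · refine stops_of (-w - 1) 0 ?_ ?_ ?_ ?_ <;> simp only [blocks, Dir.vec, Has] at * <;>
        first | omega | (rintro (_ | _ | _ | _ | _) <;> omega)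
    · refine stops_of 1 (-2) ?_ ?_ ?_ ?_ <;> simp only [blocks, Dir.vec, Has] at * <;>
        first | omega | (rintro (_ | _ | _ | _ | _) <;> omega)

/-- The third tilt of an advance of the conveyor. -/
theorem tilt_west_conveyor {C : Configuration affinity} {r q L : ℕ} (hw : 0 < w) (hr : r < h)
    (hL : L ≤ w)
    (hC : Shows h w C (Present h w r q L) (blocks h w g r L (posX r q (-2) 0)
      (posY r (fun _ => 4) 2) (-w - 1) 0 1 (-r - 1))) :
    ∃ C', Tilt .W C C' ∧ Shows h w C' (Present h w r q L)
      (blocks h w g r L (posX r q (-4) 0)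
      (posY r (fun _ => 4) 2) (-w - 1) 0 1 (-r - 1)) := by
  refine hC.tilt_free _ _ (dist r (fun _ => 2) 0 0 0) (2) ?_ ?_ ?_ ?_ ?_ ?_
  · rintro (⟨i, j⟩ | _ | _) hi <;> simp only [Present, dist] at * <;> (try split_ifs at *) <;> omega
  · rintro (⟨i, j⟩ | _ | _) hi <;> simp only [Present, blocks] at * <;> omega
  · rintro (⟨i, j⟩ | _ | _) hi <;>
      simp only [Present, dist, blocks, shift, posX, posY, Dir.vec, Block.mk.injEq, and_true] at *
      <;> (try split_ifs at *) <;> omega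
  · rintro (⟨i, j⟩ | _ | _) hi k hk X Y hXY <;>
      simp only [Present, dist, blocks, shift, posX, posY, Dir.vec, Has] at * <;>
      refine ⟨by (try split_ifs at *) <;> omega, ?_⟩
    -- The next tile ends in the shaft, whose column is not part of the conveyor.
    · by_cases hj : i = r ∧ X = 0
      · apply IsOpen.shaft <;> (try split_ifs at *) <;> omega
      · apply IsOpen.conveyor <;> (try split_ifs at *) <;> omega
    · apply IsOpen.corridor <;> omega
    · apply IsOpen.chamber <;> omega
  · rintro (⟨i, j⟩ | _ | _) hi (⟨i', j'⟩ | _ | _) hj hij k hk l hl <;>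
      simp only [Present, dist, blocks, shift, posX, posY, Dir.vec, Gap, ne_eq, Idx.tile.injEq,
        not_true_eq_false] at * <;>
      (try split_ifs at *) <;> omega
  · rintro (⟨i, j⟩ | _ | _) hi <;> simp only [Present] at hi
    · refine stops_of (posX r q (-4) 0 i j)
        (posY r (fun _ => 4) 2 i j) ?_ ?_ ?_ ?_ <;>
        simp only [blocks, posX, posY, Dir.vec, Has] at * <;>
        (try split_ifs at *) <;> first | omega | (rintro (_ | _ | _ | _ | _) <;> omega)
    · refine stops_of (-w - 1) 0 ?_ ?_ ?_ ?_ <;> simp only [blocks, Dir.vec, Has] at * <;>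
        first | omega | (rintro (_ | _ | _ | _ | _) <;> omega)
    · refine stops_of 1 (-r - 1) ?_ ?_ ?_ ?_ <;> simp only [blocks, Dir.vec, Has] at * <;>
        first | omega | (rintro (_ | _ | _ | _ | _) <;> omega)

/-- The last tilt of an advance of the conveyor, which brings the next tile to the place where it can
be accepted or rejected. -/
theorem tilt_south_conveyor {C : Configuration affinity} {r q L : ℕ} (hw : 0 < w) (hr : r < h)
    (hL : L ≤ w)
    (hC : Shows h w C (Present h w r q L) (blocks h w g r L (posX r q (-4) 0)
      (posY r (fun _ => 4) 2) (-w - 1) 0 1 (-r - 1))) :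
    ∃ C', Tilt .S C C' ∧ Shows h w C' (Present h w r q L)
      (blocks h w g r L (posX r (q + 1) 0 0)
      (posY r (fun j => if j + 1 = q + 1 then 0 else 2) 0) (-w - 1) 0 1 (-h - 1)) := by
  -- Tile `q` drops through the shaft from height 4 to the corridor; the others stop on the floor of
  -- the conveyor at height 2.
  refine hC.tilt_free _ _ (dist r (fun j => if j = q then 4 else 2) 2 0 (h - r)) (h + 4)
    ?_ ?_ ?_ ?_ ?_ ?_
  · rintro (⟨i, j⟩ | _ | _) hi <;> simp only [Present, dist] at * <;> (try split_ifs at *) <;> omega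
  · rintro (⟨i, j⟩ | _ | _) hi <;> simp only [Present, blocks] at * <;> omega
  · rintro (⟨i, j⟩ | _ | _) hi <;>
      simp only [Present, dist, blocks, shift, posX, posY, Dir.vec, Block.mk.injEq, and_true] at *
      <;> (try split_ifs at *) <;> omega
  · rintro (⟨i, j⟩ | _ | _) hi k hk X Y hXY <;>
      simp only [Present, dist, blocks, shift, posX, posY, Dir.vec, Has] at * <;>
      refine ⟨by (try split_ifs at *) <;> omega, ?_⟩
    · by_cases hj : i = r ∧ j = q
      · apply IsOpen.shaft <;> (try split_ifs at *) <;> omega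
      · apply IsOpen.conveyor <;> (try split_ifs at *) <;> omega
    · apply IsOpen.corridor <;> omega
    · apply IsOpen.chamber <;> omega
  · rintro (⟨i, j⟩ | _ | _) hi (⟨i', j'⟩ | _ | _) hj hij k hk l hl <;>
      simp only [Present, dist, blocks, shift, posX, posY, Dir.vec, Gap, ne_eq, Idx.tile.injEq,
        not_true_eq_false] at * <;>
      (try split_ifs at *) <;> omega
  · rintro (⟨i, j⟩ | _ | _) hi <;> simp only [Present] at hi
    · refine stops_of (posX r (q + 1) 0 0 i j)
        (posY r (fun j => if j + 1 = q + 1 then 0 else 2) 0 i j) ?_ ?_ ?_ ?_ <;>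
        simp only [blocks, posX, posY, Dir.vec, Has] at * <;>
        (try split_ifs at *) <;> first | omega | (rintro (_ | _ | _ | _ | _) <;> omega)
    · refine stops_of (-w - 1) 0 ?_ ?_ ?_ ?_ <;> simp only [blocks, Dir.vec, Has] at * <;>
        first | omega | (rintro (_ | _ | _ | _ | _) <;> omega)
    · refine stops_of 1 (-h - 1) ?_ ?_ ?_ ?_ <;> simp only [blocks, Dir.vec, Has] at * <;>
        first | omega | (rintro (_ | _ | _ | _ | _) <;> omega)

/-- A tilt to the south that takes the lifted tiles and the completed rows back to rest. -/
theorem tilt_south_settle {C : Configuration affinity} {r q L : ℕ} {ey : ℤ} (hw : 0 < w)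
    (hr : r ≤ h) (hL : L ≤ w) (he : -h - 1 ≤ ey) (he' : ey ≤ -r - 1)
    (hC : Shows h w C (Present h w r q L) (blocks h w g r L (posX r q 0 0)
      (posY r (fun _ => 4) 2) (-w - 1) 0 1 ey)) :
    ∃ C', Tilt .S C C' ∧ Shows h w C' (Present h w r q L)
      (blocks h w g r L (posX r q 0 0)
      (posY r (fun j => if j + 1 = q then 0 else 2) 0) (-w - 1) 0 1 (-h - 1)) := by
  refine hC.tilt_free _ _ (dist r (fun _ => 2) 2 0 (ey + h + 1).toNat) (h + 4)
    ?_ ?_ ?_ ?_ ?_ ?_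
  · rintro (⟨i, j⟩ | _ | _) hi <;> simp only [Present, dist] at * <;> (try split_ifs at *) <;> omega
  · rintro (⟨i, j⟩ | _ | _) hi <;> simp only [Present, blocks] at * <;> omega
  · rintro (⟨i, j⟩ | _ | _) hi <;>
      simp only [Present, dist, blocks, shift, posX, posY, Dir.vec, Block.mk.injEq, and_true] at *
      <;> (try split_ifs at *) <;> omega
  · rintro (⟨i, j⟩ | _ | _) hi k hk X Y hXY <;>
      simp only [Present, dist, blocks, shift, posX, posY, Dir.vec, Has] at * <;>
      refine ⟨by (try split_ifs at *) <;> omega, ?_⟩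
    · apply IsOpen.conveyor <;> (try split_ifs at *) <;> omega
    · apply IsOpen.corridor <;> omega
    · apply IsOpen.chamber <;> omega
  · rintro (⟨i, j⟩ | _ | _) hi (⟨i', j'⟩ | _ | _) hj hij k hk l hl <;>
      simp only [Present, dist, blocks, shift, posX, posY, Dir.vec, Gap, ne_eq, Idx.tile.injEq,
        not_true_eq_false] at * <;>
      (try split_ifs at *) <;> omega
  · rintro (⟨i, j⟩ | _ | _) hi <;> simp only [Present] at hi
    · refine stops_of (posX r q 0 0 i j)
        (posY r (fun j => if j + 1 = q then 0 else 2) 0 i j) ?_ ?_ ?_ ?_ <;>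
        simp only [blocks, posX, posY, Dir.vec, Has] at * <;>
        (try split_ifs at *) <;> first | omega | (rintro (_ | _ | _ | _ | _) <;> omega)
    · refine stops_of (-w - 1) 0 ?_ ?_ ?_ ?_ <;> simp only [blocks, Dir.vec, Has] at * <;>
        first | omega | (rintro (_ | _ | _ | _ | _) <;> omega)
    · refine stops_of 1 (-h - 1) ?_ ?_ ?_ ?_ <;> simp only [blocks, Dir.vec, Has] at * <;>
        first | omega | (rintro (_ | _ | _ | _ | _) <;> omega)

/-- A complete row moves to the east, above the chute. -/
theorem tilt_east_row {C : Configuration affinity} {r q : ℕ} {a : ℕ → ℤ} (hw : 0 < w)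
    (hr : r < h)
    (hC : Shows h w C (Present h w r (2 * w) w)
      (blocks h w g r w (posX r q 0 0) (posY r a 0) (-w - 1) 0 1 (-h - 1))) :
    ∃ C', Tilt .E C C' ∧ Shows h w C' (Present h w r (2 * w) w)
      (blocks h w g r w (posX r q 0 1) (posY r a 0) 2 0 2 (-h - 1)) := by
  -- All `2 * w` tiles of this row are used, so `a` is irrelevant. The row goes from `-w - 1` to `2`
  -- and the completed rows from `1` to `2`, which aligns them for the fall.
  refine hC.tilt_free _ _ (dist r (fun _ => 1) 1 (w + 3) 1) (w + 3) ?_ ?_ ?_ ?_ ?_ ?_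
  · rintro (⟨i, j⟩ | _ | _) hi <;> simp only [Present, dist] at * <;> (try split_ifs at *) <;> omega
  · rintro (⟨i, j⟩ | _ | _) hi <;> simp only [Present, blocks] at * <;> omega
  · rintro (⟨i, j⟩ | _ | _) hi <;>
      simp only [Present, dist, blocks, shift, posX, posY, Dir.vec, Block.mk.injEq, and_true] at *
      <;> (try split_ifs at *) <;> omega
  · rintro (⟨i, j⟩ | _ | _) hi k hk X Y hXY <;>
      simp only [Present, dist, blocks, shift, posX, posY, Dir.vec, Has] at * <;>
      refine ⟨by (try split_ifs at *) <;> omega, ?_⟩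
    · apply IsOpen.conveyor <;> (try split_ifs at *) <;> omega
    · apply IsOpen.corridor <;> omega
    · apply IsOpen.chamber <;> omega
  · rintro (⟨i, j⟩ | _ | _) hi (⟨i', j'⟩ | _ | _) hj hij k hk l hl <;>
      simp only [Present, dist, blocks, shift, posX, posY, Dir.vec, Gap, ne_eq, Idx.tile.injEq,
        not_true_eq_false] at * <;>
      (try split_ifs at *) <;> omega
  · rintro (⟨i, j⟩ | _ | _) hi <;> simp only [Present] at hi
    · refine stops_of (posX r q 0 1 i j)
        (posY r a 0 i j) ?_ ?_ ?_ ?_ <;>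
        simp only [blocks, posX, posY, Dir.vec, Has] at * <;>
        (try split_ifs at *) <;> first | omega | (rintro (_ | _ | _ | _ | _) <;> omega)
    · refine stops_of (w + 1) 0 ?_ ?_ ?_ ?_ <;> simp only [blocks, Dir.vec, Has] at * <;>
        first | omega | (rintro (_ | _ | _ | _ | _) <;> omega)
    · refine stops_of (w + 1) (-h - 1) ?_ ?_ ?_ ?_ <;> simp only [blocks, Dir.vec, Has] at * <;>
        first | omega | (rintro (_ | _ | _ | _ | _) <;> omega)

/-- The completed rows move to the west, below the ceiling of the chamber. -/
theorem tilt_west_rect {C : Configuration affinity} {r : ℕ} (hw : 0 < w)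
    (hr : r ≤ h)
    (hC : Shows h w C (Present h w r 0 0) (blocks h w g r 0 (posX r 0 1 1)
      (posY r (fun _ => 4) 2) (-w - 1) 0 2 (-h - 1))) :
    ∃ C', Tilt .W C C' ∧ Shows h w C' (Present h w r 0 0)
      (blocks h w g r 0 (posX r 0 0 0)
      (posY r (fun _ => 4) 2) (-w - 1) 0 1 (-h - 1)) := by
  refine hC.tilt_free _ _ (dist r (fun _ => 1) 1 0 1) (1) ?_ ?_ ?_ ?_ ?_ ?_
  · rintro (⟨i, j⟩ | _ | _) hi <;> simp only [Present, dist] at * <;> (try split_ifs at *) <;> omega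
  · rintro (⟨i, j⟩ | _ | _) hi <;> simp only [Present, blocks] at * <;> omega
  · rintro (⟨i, j⟩ | _ | _) hi <;>
      simp only [Present, dist, blocks, shift, posX, posY, Dir.vec, Block.mk.injEq, and_true] at *
      <;> (try split_ifs at *) <;> omega
  · rintro (⟨i, j⟩ | _ | _) hi k hk X Y hXY <;>
      simp only [Present, dist, blocks, shift, posX, posY, Dir.vec, Has] at * <;>
      refine ⟨by (try split_ifs at *) <;> omega, ?_⟩
    · apply IsOpen.conveyor <;> (try split_ifs at *) <;> omega
    · apply IsOpen.corridor <;> omega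
    · apply IsOpen.chamber <;> omega
  · rintro (⟨i, j⟩ | _ | _) hi (⟨i', j'⟩ | _ | _) hj hij k hk l hl <;>
      simp only [Present, dist, blocks, shift, posX, posY, Dir.vec, Gap, ne_eq, Idx.tile.injEq,
        not_true_eq_false] at * <;>
      (try split_ifs at *) <;> omega
  · rintro (⟨i, j⟩ | _ | _) hi <;> simp only [Present] at hi
    · refine stops_of (posX r 0 0 0 i j)
        (posY r (fun _ => 4) 2 i j) ?_ ?_ ?_ ?_ <;>
        simp only [blocks, posX, posY, Dir.vec, Has] at * <;>
        (try split_ifs at *) <;> first | omega | (rintro (_ | _ | _ | _ | _) <;> omega)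
    · refine stops_of (-w - 1) 0 ?_ ?_ ?_ ?_ <;> simp only [blocks, Dir.vec, Has] at * <;>
        first | omega | (rintro (_ | _ | _ | _ | _) <;> omega)
    · refine stops_of 1 (-h - 1) ?_ ?_ ?_ ?_ <;> simp only [blocks, Dir.vec, Has] at * <;>
        first | omega | (rintro (_ | _ | _ | _ | _) <;> omega)


/-! ### Accepting and rejecting the waiting tile. -/

/-- The configuration at rest, when `r` rows are complete, the conveyor has advanced by `q` places,
`s` tiles of the next row have been used, and the row under construction has length `L`. -/
def Rest (h w : ℕ) (g : ℤ → ℤ → Fin 2) (r q s L : ℕ) (C : Configuration affinity) : Prop :=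
  Shows h w C (Present h w r s L) (blocks h w g r L (posX r q 0 0)
    (posY r (fun j => if j + 1 = q then 0 else 2) 0) (-w - 1) 0 1 (-h - 1))

/-- The tile that is ready to be accepted slides west and becomes the first tile of a row. -/
theorem tilt_west_first {C : Configuration affinity} {r s : ℕ} (hw : 0 < w) (hr : r < h)
    (hs : s < 2 * w) (hg : g 0 r = sym s) (hC : Rest h w g r (s + 1) s 0 C) :
    ∃ C', Tilt .W C C' ∧ Shows h w C' (Present h w r (s + 1) 1)
      (blocks h w g r 1 (posX r (s + 1) (-2) 0) (posY r (fun _ => 2) 0) (-w - 1) 0 1 (-h - 1)) := by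
  have hT := hC.tilt_free .W _ (dist r (fun j => if j = s then w + 1 else 2) 0 0 0) (w + 2)
    ?_ ?_ (fun _ _ => rfl) ?_ ?_ ?_
  · obtain ⟨C', h1, h2⟩ := hT
    refine ⟨C', h1, h2.relabel (.tile r s) .row ?_ ?_ ?_ ?_⟩
    · exact ⟨hr, hs, .inl ⟨rfl, le_rfl⟩⟩
    · rintro (⟨i, j⟩ | _ | _) <;> simp [Present]
      omega
    · rintro (⟨i, j⟩ | _ | _) hi hne <;> congr 1 <;>
        simp only [Present, dist, blocks, shift, posX, posY, Dir.vec, Block.mk.injEq, and_true,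
          ne_eq, Idx.tile.injEq] at * <;>
        (try split_ifs at *) <;> omega
    · ext ⟨⟨X, Y⟩, l⟩
      simp only [cells, Has, dist, blocks, shift, posX, posY, Dir.vec, if_true, Set.mem_ofPred_eq,
        Nat.cast_add, Nat.cast_one]
      constructor
      · rintro ⟨hX, hl⟩
        refine ⟨by omega, ?_⟩
        rw [hl, ← hg]
        congr 2
        omega
      · rintro ⟨hX, hl⟩
        refine ⟨by omega, ?_⟩
        rw [hl, ← hg]
        congr 2
        omega
  · rintro (⟨i, j⟩ | _ | _) hi <;> simp only [Present, dist] at * <;> (try split_ifs at *) <;> omega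
  · rintro (⟨i, j⟩ | _ | _) hi <;> simp only [Present, blocks] at * <;> omega
  · rintro (⟨i, j⟩ | _ | _) hi k hk X Y hXY <;>
      simp only [Present, dist, blocks, shift, posX, posY, Dir.vec, Has] at * <;>
      refine ⟨by (try split_ifs at *) <;> omega, ?_⟩
    · by_cases hj : i = r ∧ j = s
      · apply IsOpen.corridor <;> (try split_ifs at *) <;> omega
      · apply IsOpen.conveyor <;> (try split_ifs at *) <;> omega
    · apply IsOpen.corridor <;> omega
    · apply IsOpen.chamber <;> omega
  · rintro (⟨i, j⟩ | _ | _) hi (⟨i', j'⟩ | _ | _) hj hij k hk l hl <;>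
      simp only [Present, dist, blocks, shift, posX, posY, Dir.vec, Gap, ne_eq, Idx.tile.injEq,
        not_true_eq_false] at * <;>
      (try split_ifs at *) <;> omega
  · rintro (⟨i, j⟩ | _ | _) hi <;> simp only [Present] at hi
    · refine stops_of (if i = r ∧ j = s then -w - 1 else posX r (s + 1) (-2) 0 i j)
        (posY r (fun j => if j + 1 = s + 1 then 0 else 2) 0 i j) ?_ ?_ ?_ ?_ <;>
        simp only [dist, shift, blocks, posX, posY, Dir.vec, Has] at * <;>
        (try split_ifs at *) <;> first | omega | (rintro (_ | _ | _ | _ | _) <;> omega)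
    · omega
    · refine stops_of 1 (-h - 1) ?_ ?_ ?_ ?_ <;>
        simp only [dist, shift, blocks, Dir.vec, Has] at * <;>
        first | omega | (rintro (_ | _ | _ | _ | _) <;> omega)

/-- The tile that is ready to be accepted slides west and joins the row under construction. -/
theorem tilt_west_join {C : Configuration affinity} {r s L : ℕ} (hr : r < h)
    (hs : s < 2 * w) (hL : L < w) (hL0 : 0 < L) (hg : g L r = sym s)
    (hC : Rest h w g r (s + 1) s L C) :
    ∃ C', Tilt .W C C' ∧ Shows h w C' (Present h w r (s + 1) (L + 1))
      (blocks h w g r (L + 1) (posX r (s + 1) (-2) 0) (posY r (fun _ => 2) 0)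
        (-w - 1) 0 1 (-h - 1)) := by
  -- The corridor keeps column `-1` free between a full row and the waiting tile. Hence `w + 1 - L`
  -- is at least 2, and the joining tile moves no less than the conveyor, as the merging lemma
  -- requires.
  refine hC.tilt_merge .W _ _ (dist r (fun j => if j = s then w + 1 - L else 2) 0 0 0)
    (.tile r s) .row ?_ hL0 ?_ ?_ ?_ (fun _ _ => rfl) ?_ ?_ rfl ?_ ?_ ?_ ?_ ?_ ?_ ?_
  · exact ⟨hr, hs, .inl ⟨rfl, le_rfl⟩⟩
  · simp only [dist, if_true]
    omega
  · rintro (⟨i, j⟩ | _ | _) hi <;> simp only [Present, dist] at * <;> (try split_ifs at *) <;> omega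
  · rintro (⟨i, j⟩ | _ | _) hi <;> simp only [Present, blocks] at * <;> omega
  · rintro (⟨i, j⟩ | _ | _) hi k hk X Y hXY <;>
      simp only [Present, dist, blocks, shift, posX, posY, Dir.vec, Has] at * <;>
      refine ⟨by (try split_ifs at *) <;> omega, ?_⟩
    · by_cases hj : i = r ∧ j = s
      · apply IsOpen.corridor <;> (try split_ifs at *) <;> omega
      · apply IsOpen.conveyor <;> (try split_ifs at *) <;> omega
    · apply IsOpen.corridor <;> omega
    · apply IsOpen.chamber <;> omega
  · rintro (⟨i, j⟩ | _ | _) hi (⟨i', j'⟩ | _ | _) hj hij hij1 hij2 k hk l hl <;>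
      simp only [Present, dist, blocks, shift, posX, posY, Dir.vec, Gap, ne_eq, Idx.tile.injEq,
        not_true_eq_false, reduceCtorEq, and_true, true_and, and_false, false_and,
        not_false_eq_true] at * <;>
      (try split_ifs at *) <;> omega
  · intro k hk
    simp only [dist, blocks, shift, posX, posY, Dir.vec, Gap, if_true] at *
    omega
  · simp only [dist, blocks, shift, posX, posY, Dir.vec, Disj, if_true]
    omega
  · rintro (⟨i, j⟩ | _ | _) hi hne <;> simp only [Present, ne_eq, Idx.tile.injEq] at hi hne
    · refine stops_of (posX r (s + 1) (-2) 0 i j)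
        (posY r (fun j => if j + 1 = s + 1 then 0 else 2) 0 i j) ?_ ?_ ?_ ?_ <;>
        simp only [dist, shift, blocks, posX, posY, Dir.vec, Has] at * <;>
        (try split_ifs at *) <;> first | omega | (rintro (_ | _ | _ | _ | _) <;> omega)
    · refine stops_of (-w - 1) 0 ?_ ?_ ?_ ?_ <;>
        simp only [dist, shift, blocks, Dir.vec, Has] at * <;>
        first | omega | (rintro (_ | _ | _ | _ | _) <;> omega)
    · refine stops_of 1 (-h - 1) ?_ ?_ ?_ ?_ <;>
        simp only [dist, shift, blocks, Dir.vec, Has] at * <;>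
        first | omega | (rintro (_ | _ | _ | _ | _) <;> omega)
  · refine ⟨-w - 1 + L + (w + 3), 0 + (h + 3), ?_, ?_⟩ <;>
      simp only [dist, shift, blocks, posX, posY, Dir.vec, Has, if_true] <;> omega
  · rintro (⟨i, j⟩ | _ | _) <;> simp [Present] <;> omega
  · rintro (⟨i, j⟩ | _ | _) hi hne hne' <;>
      simp only [Present, dist, blocks, shift, posX, posY, Dir.vec, Block.mk.injEq, and_true, ne_eq,
        Idx.tile.injEq, not_true_eq_false] at * <;>
      (try split_ifs at *) <;> omega
  · ext ⟨⟨X, Y⟩, l⟩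
    simp only [cells, Has, dist, blocks, shift, posX, posY, Dir.vec, if_true, Set.mem_union,
      Set.mem_ofPred_eq, Nat.cast_add, Nat.cast_one]
    constructor
    · rintro ⟨hX, hl⟩
      by_cases hXL : X = -w - 1 + (w + 3) + L
      · refine .inl ⟨by omega, ?_⟩
        rw [hl, ← hg, hXL]
        congr 2
        ring
      · refine .inr ⟨by omega, ?_⟩
        rw [hl]
        congr 2
        omega
    · rintro (⟨hX, hl⟩ | ⟨hX, hl⟩)
      · refine ⟨by omega, ?_⟩
        rw [hl, ← hg]
        congr 2
        omega
      · refine ⟨by omega, ?_⟩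
        rw [hl]
        congr 2
        omega

/-- The tile that is ready to be accepted leaves the board through the northern exit. -/
theorem tilt_north_reject {C : Configuration affinity} {r s L : ℕ} (hw : 0 < w) (hr : r < h)
    (hL : L ≤ w) (hC : Rest h w g r (s + 1) s L C) :
    ∃ C', Tilt .N C C' ∧ Shows h w C' (Present h w r (s + 1) L)
      (blocks h w g r L (posX r (s + 1) 0 0) (posY r (fun _ => 4) 2) (-w - 1) 0 1 (-r - 1)) := by
  -- The top row of the board has relative height `4 * h + 1`, so `4 * h + 2` is the first height
  -- outside.
  have hT := hC.tilt_exit .N _ (dist r (fun j => if j = s then 4 * h + 2 else 2) 2 0 (h - r))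
    (.tile r s) (I' := Present h w r (s + 1) L) ?_ ?_ ?_ ?_ (fun _ _ => rfl) ?_ ?_ ?_ ?_
  · obtain ⟨C', h1, h2⟩ := hT
    refine ⟨C', h1, h2.congr (fun _ => Iff.rfl) ?_⟩
    rintro (⟨i, j⟩ | _ | _) hi <;>
      simp only [Present, dist, blocks, shift, Block.mk.injEq, posX, posY, Dir.vec, and_true] at *
      <;> (try split_ifs at *) <;> omega
  · simp only [dist, if_true]
    omega
  · rintro (⟨i, j⟩ | _ | _) <;> simp [Present] <;> omega
  · rintro (⟨i, j⟩ | _ | _) hi <;> simp only [Present, dist] at * <;> (try split_ifs at *) <;> omega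
  · rintro (⟨i, j⟩ | _ | _) hi <;> simp only [Present, blocks] at * <;> omega
  · rintro (⟨i, j⟩ | _ | _) hi k hk hku X Y hXY <;>
      simp only [Present, dist, blocks, shift, posX, posY, Dir.vec, Has, Idx.tile.injEq,
        if_true] at * <;>
      refine ⟨by (try split_ifs at *) <;> omega, ?_⟩
    · by_cases hj : i = r ∧ j = s
      · apply IsOpen.shaft <;> (try split_ifs at *) <;> omega
      · apply IsOpen.conveyor <;> (try split_ifs at *) <;> omega
    · apply IsOpen.corridor <;> omega
    · apply IsOpen.chamber <;> omega
  · intro x y hxy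
    simp only [dist, blocks, shift, posX, posY, Dir.vec, Has, if_true] at hxy
    omega
  · rintro (⟨i, j⟩ | _ | _) hi (⟨i', j'⟩ | _ | _) hj hij k hk l hl <;>
      simp only [Present, dist, blocks, shift, posX, posY, Dir.vec, Gap, ne_eq, Idx.tile.injEq,
        not_true_eq_false] at * <;>
      (try split_ifs at *) <;> omega
  · rintro (⟨i, j⟩ | _ | _) hi <;> simp only [Present] at hi
    · refine stops_of (posX r (s + 1) 0 0 i j) (posY r (fun _ => 4) 2 i j) ?_ ?_ ?_ ?_ <;>
        simp only [dist, shift, blocks, posX, posY, Dir.vec, Has] at * <;>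
        (try split_ifs at *) <;> first | omega | (rintro (_ | _ | _ | _ | _) <;> omega)
    · refine stops_of (-w - 1) 0 ?_ ?_ ?_ ?_ <;>
        simp only [dist, shift, blocks, Dir.vec, Has] at * <;>
        first | omega | (rintro (_ | _ | _ | _ | _) <;> omega)
    · refine stops_of 1 (-2) ?_ ?_ ?_ ?_ <;>
        simp only [dist, shift, blocks, Dir.vec, Has] at * <;>
        first | omega | (rintro (_ | _ | _ | _ | _) <;> omega)


/-! ### Dropping a complete row into the chamber. -/

/-- The first complete row falls to the bottom of the chamber. -/
theorem tilt_south_first {C : Configuration affinity} {q : ℕ} (hw : 0 < w) (hh : 0 < h)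
    (hC : Shows h w C (Present h w 0 (2 * w) w)
      (blocks h w g 0 w (posX 0 q 0 1) (posY 0 (fun _ => 2) 0) 2 0 2 (-h - 1))) :
    ∃ C', Tilt .S C C' ∧ Shows h w C' (Present h w 1 0 0)
      (blocks h w g 1 0 (posX 1 0 1 1) (posY 1 (fun _ => 4) 2) (-w - 1) 0 2 (-h - 1)) := by
  have hT := hC.tilt_free .S _ (dist 0 (fun _ => 2) 2 (h + 1) 0) (h + 2)
    ?_ ?_ (fun _ _ => rfl) ?_ ?_ ?_
  · obtain ⟨C', h1, h2⟩ := hT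
    refine ⟨C', h1, h2.relabel .row .rect hw ?_ ?_ ?_⟩
    · rintro (⟨i, j⟩ | _ | _) <;> simp [Present] <;> omega
    · rintro (⟨i, j⟩ | _ | _) hi hne <;> congr 1 <;>
        simp only [Present, dist, blocks, shift, posX, posY, Dir.vec, Block.mk.injEq, and_true,
          ne_eq, not_true_eq_false] at * <;>
        (try split_ifs at *) <;> omega
    · ext ⟨⟨X, Y⟩, l⟩
      simp only [cells, Has, dist, blocks, shift, Dir.vec, Set.mem_ofPred_eq, Nat.cast_add,
        Nat.cast_one, Nat.cast_zero]
      constructor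
      · rintro ⟨hX, hl⟩
        refine ⟨by omega, ?_⟩
        rw [hl]
        congr 2 <;> omega
      · rintro ⟨hX, hl⟩
        refine ⟨by omega, ?_⟩
        rw [hl]
        congr 2 <;> omega
  · rintro (⟨i, j⟩ | _ | _) hi <;> simp only [Present, dist] at * <;> (try split_ifs at *) <;> omega
  · rintro (⟨i, j⟩ | _ | _) hi <;> simp only [Present, blocks] at * <;> omega
  · rintro (⟨i, j⟩ | _ | _) hi k hk X Y hXY <;>
      simp only [Present, dist, blocks, shift, posX, posY, Dir.vec, Has] at * <;>
      refine ⟨by (try split_ifs at *) <;> omega, ?_⟩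
    · apply IsOpen.conveyor <;> (try split_ifs at *) <;> omega
    · obtain hY | hY | hY : Y = 0 ∨ Y = -1 ∨ Y ≤ -2 := by omega
      · apply IsOpen.corridor <;> omega
      · apply IsOpen.chute <;> omega
      · apply IsOpen.chamber <;> omega
    · omega
  · rintro (⟨i, j⟩ | _ | _) hi (⟨i', j'⟩ | _ | _) hj hij k hk l hl <;>
      simp only [Present, dist, blocks, shift, posX, posY, Dir.vec, Gap, ne_eq, Idx.tile.injEq,
        not_true_eq_false] at * <;>
      (try split_ifs at *) <;> omega
  · rintro (⟨i, j⟩ | _ | _) hi <;> simp only [Present] at hi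
    · refine stops_of (posX 0 q 0 1 i j) (posY 0 (fun _ => 2) (-2) i j) ?_ ?_ ?_ ?_ <;>
        simp only [dist, shift, blocks, posX, posY, Dir.vec, Has] at * <;>
        (try split_ifs at *) <;> first | omega | (rintro (_ | _ | _ | _ | _) <;> omega)
    · refine stops_of 2 (-h - 1) ?_ ?_ ?_ ?_ <;>
        simp only [dist, shift, blocks, Dir.vec, Has] at * <;>
        first | omega | (rintro (_ | _ | _ | _ | _) <;> omega)
    · omega

/-- A complete row falls onto the previous rows and joins them. -/
theorem tilt_south_join {C : Configuration affinity} {r q : ℕ} (hw : 0 < w) (hr : r < h)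
    (hr0 : 0 < r) (hC : Shows h w C (Present h w r (2 * w) w)
      (blocks h w g r w (posX r q 0 1) (posY r (fun _ => 2) 0) 2 0 2 (-h - 1))) :
    ∃ C', Tilt .S C C' ∧ Shows h w C' (Present h w (r + 1) 0 0)
      (blocks h w g (r + 1) 0 (posX (r + 1) 0 1 1) (posY (r + 1) (fun _ => 4) 2)
        (-w - 1) 0 2 (-h - 1)) := by
  -- The row falls from height 0 to `-h - 1 + r`. As `r < h`, this takes at least the two steps of
  -- the storage.
  refine hC.tilt_merge .S _ _ (dist r (fun _ => 2) 2 (h + 1 - r) 0)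
    .row .rect hw hr0 ?_ ?_ ?_ (fun _ _ => rfl) ?_ ?_ rfl ?_ ?_ ?_ ?_ ?_ ?_ ?_
  · simp only [dist]
    omega
  · rintro (⟨i, j⟩ | _ | _) hi <;> simp only [Present, dist] at * <;> (try split_ifs at *) <;> omega
  · rintro (⟨i, j⟩ | _ | _) hi <;> simp only [Present, blocks] at * <;> omega
  · rintro (⟨i, j⟩ | _ | _) hi k hk X Y hXY <;>
      simp only [Present, dist, blocks, shift, posX, posY, Dir.vec, Has] at * <;>
      refine ⟨by (try split_ifs at *) <;> omega, ?_⟩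
    · apply IsOpen.conveyor <;> (try split_ifs at *) <;> omega
    · obtain hY | hY | hY : Y = 0 ∨ Y = -1 ∨ Y ≤ -2 := by omega
      · apply IsOpen.corridor <;> omega
      · apply IsOpen.chute <;> omega
      · apply IsOpen.chamber <;> omega
    · apply IsOpen.chamber <;> omega
  · rintro (⟨i, j⟩ | _ | _) hi (⟨i', j'⟩ | _ | _) hj hij hij1 hij2 k hk l hl <;>
      simp only [Present, dist, blocks, shift, posX, posY, Dir.vec, Gap, ne_eq, Idx.tile.injEq,
        not_true_eq_false, reduceCtorEq, and_true, and_false, false_and,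
        not_false_eq_true] at * <;>
      (try split_ifs at *) <;> omega
  · intro k hk
    simp only [dist, blocks, shift, Dir.vec, Gap] at *
    omega
  · simp only [dist, blocks, shift, Dir.vec, Disj]
    omega
  · rintro (⟨i, j⟩ | _ | _) hi hne <;> simp only [Present, ne_eq, not_true_eq_false] at hi hne
    · refine stops_of (posX r q 0 1 i j) (posY r (fun _ => 2) (-2) i j) ?_ ?_ ?_ ?_ <;>
        simp only [dist, shift, blocks, posX, posY, Dir.vec, Has] at * <;>
        (try split_ifs at *) <;> first | omega | (rintro (_ | _ | _ | _ | _) <;> omega)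
    · refine stops_of 2 (-h - 1) ?_ ?_ ?_ ?_ <;>
        simp only [dist, shift, blocks, Dir.vec, Has] at * <;>
        first | omega | (rintro (_ | _ | _ | _ | _) <;> omega)
  · refine ⟨2 + (w + 3), -h - 1 + r + (h + 3), ?_, ?_⟩ <;>
      simp only [dist, shift, blocks, Dir.vec, Has] <;> omega
  · rintro (⟨i, j⟩ | _ | _) <;> simp [Present] <;> omega
  · rintro (⟨i, j⟩ | _ | _) hi hne hne' <;>
      simp only [Present, dist, blocks, shift, posX, posY, Dir.vec, Block.mk.injEq, and_true, ne_eq,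
        not_true_eq_false] at * <;>
      (try split_ifs at *) <;> omega
  · ext ⟨⟨X, Y⟩, l⟩
    simp only [cells, Has, dist, blocks, shift, Dir.vec, Set.mem_union,
      Set.mem_ofPred_eq, Nat.cast_add, Nat.cast_one]
    constructor
    · rintro ⟨hX, hl⟩
      by_cases hY : Y = 2 + r
      · refine .inl ⟨by omega, ?_⟩
        rw [hl]
        congr 2 <;> omega
      · refine .inr ⟨by omega, ?_⟩
        rw [hl]
        congr 2 <;> omega
    · rintro (⟨hX, hl⟩ | ⟨hX, hl⟩)
      · refine ⟨by omega, ?_⟩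
        rw [hl]
        congr 2 <;> omega
      · refine ⟨by omega, ?_⟩
        rw [hl]
        congr 2 <;> omega

end Machine
end TiltModel

/-! ### Tilt sequences that assemble a pattern. -/

namespace TiltModel

section Sequences

variable {L : Type} {G : L → L → Bool}

theorem TiltSequence.append {D D' : List Dir} {C C' C'' : Configuration G}
    (h : TiltSequence D C C') (h' : TiltSequence D' C' C'') : TiltSequence (D ++ D') C C'' := by
  induction h with
  | nil => exact h'
  | cons ht _ ih => exact .cons ht (ih h')

theorem TiltSequence.reconfigurable {D : List Dir} {C C' : Configuration G}
    (h : TiltSequence D C C') (hD : D ≠ []) : Reconfigurable C C' := by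
  induction h with
  | nil => exact absurd rfl hD
  | @cons d D _ _ _ ht hs ih =>
    cases D with
    | nil =>
      cases hs
      exact .single ⟨d, ht⟩
    | cons => exact .head ⟨d, ht⟩ (ih (List.cons_ne_nil _ _))

end Sequences

namespace Machine

open Block

variable {h w : ℕ} {g : ℤ → ℤ → Fin 2}

/-- The first west tilt is a hypothesis because accepting and idling differ only there. -/
theorem advance {C C₁ : Configuration affinity} {r q L : ℕ} (hw : 0 < w) (hr : r < h)
    (hL : L ≤ w) (hT : Tilt .W C C₁)
    (h₁ : Shows h w C₁ (Present h w r q L) (blocks h w g r L (posX r q (-2) 0)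
      (posY r (fun _ => 2) 0) (-w - 1) 0 1 (-h - 1))) :
    ∃ C', TiltSequence [.W, .N, .W, .S] C C' ∧ Rest h w g r (q + 1) q L C' := by
  obtain ⟨C₂, t₂, h₂⟩ := tilt_north_conveyor hw hr hL h₁
  obtain ⟨C₃, t₃, h₃⟩ := tilt_west_conveyor hw hr hL h₂
  obtain ⟨C₄, t₄, h₄⟩ := tilt_south_conveyor hw hr hL h₃
  exact ⟨C₄, .cons hT (.cons t₂ (.cons t₃ (.cons t₄ (.nil _)))), h₄⟩

theorem advance_idle {C : Configuration affinity} {r q L : ℕ} (hw : 0 < w) (hr : r < h)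
    (hL : L ≤ w) (hC : Rest h w g r q q L C) :
    ∃ C', TiltSequence [.W, .N, .W, .S] C C' ∧ Rest h w g r (q + 1) q L C' := by
  obtain ⟨C₁, t₁, h₁⟩ := tilt_west_idle hw hr hL hC
  exact advance hw hr hL t₁ h₁

/-- The west tilt that takes the waiting tile into the row is also the first tilt of an advance, so
the next tile arrives without extra cost. -/
theorem accept {C : Configuration affinity} {r s L : ℕ} (hr : r < h)
    (hL : L < w) (hs : s < 2 * w) (hg : g L r = sym s) (hC : Rest h w g r (s + 1) s L C) :
    ∃ C', TiltSequence [.W, .N, .W, .S] C C' ∧ Rest h w g r (s + 2) (s + 1) (L + 1) C' := by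
  rcases Nat.eq_zero_or_pos L with rfl | hL0
  · obtain ⟨C₁, t₁, h₁⟩ := tilt_west_first hL hr hs (by simpa using hg) hC
    exact advance hL hr hL t₁ h₁
  · obtain ⟨C₁, t₁, h₁⟩ := tilt_west_join hr hs hL hL0 hg hC
    exact advance (by omega) hr hL t₁ h₁

/-- The conveyor is lifted and put back in the same columns, so the decision place is left empty. -/
theorem reject {C : Configuration affinity} {r s L : ℕ} (hw : 0 < w) (hr : r < h)
    (hL : L ≤ w) (hC : Rest h w g r (s + 1) s L C) :
    ∃ C', TiltSequence [.N, .S] C C' ∧ Rest h w g r (s + 1) (s + 1) L C' := by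
  obtain ⟨C₁, t₁, h₁⟩ := tilt_north_reject hw hr hL hC
  obtain ⟨C₂, t₂, h₂⟩ := tilt_south_settle hw hr.le hL (by omega) le_rfl h₁
  exact ⟨C₂, .cons t₁ (.cons t₂ (.nil _)), h₂⟩

theorem sym_even (c : ℕ) : sym (2 * c) = 0 := by simp [sym]

theorem sym_odd (c : ℕ) : sym (2 * c + 1) = 1 := by simp [sym]

/-- Ten tilts append one pixel to the row under construction. -/
theorem append_pixel {C : Configuration affinity} {r c : ℕ} (hr : r < h) (hc : c < w)
    (hC : Rest h w g r (2 * c + 1) (2 * c) c C) :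
    ∃ D C', D.length = 10 ∧ TiltSequence D C C' ∧
      Rest h w g r (2 * (c + 1) + 1) (2 * (c + 1)) (c + 1) C' := by
  have hw : 0 < w := by omega
  obtain hg | hg : g c r = 0 ∨ g c r = 1 := by
    generalize g c r = x
    revert x
    decide
  · obtain ⟨C₁, t₁, h₁⟩ := accept hr hc (by omega) (hg.trans (sym_even c).symm) hC
    obtain ⟨C₂, t₂, h₂⟩ := reject hw hr (by omega) h₁
    obtain ⟨C₃, t₃, h₃⟩ := advance_idle hw hr (by omega) h₂
    exact ⟨_, C₃, rfl, t₁.append (t₂.append t₃), h₃⟩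
  · obtain ⟨C₁, t₁, h₁⟩ := reject hw hr (by omega) hC
    obtain ⟨C₂, t₂, h₂⟩ := advance_idle hw hr (by omega) h₁
    obtain ⟨C₃, t₃, h₃⟩ := accept hr hc (by omega) (hg.trans (sym_odd c).symm) h₂
    exact ⟨_, C₃, rfl, t₁.append (t₂.append t₃), h₃⟩

theorem append_pixels {C : Configuration affinity} {r : ℕ} (hr : r < h)
    (hC : Rest h w g r 1 0 0 C) (c : ℕ) (hc : c ≤ w) :
    ∃ D C', D.length = 10 * c ∧ TiltSequence D C C' ∧
      Rest h w g r (2 * c + 1) (2 * c) c C' := by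
  induction c with
  | zero => exact ⟨[], C, rfl, .nil C, hC⟩
  | succ c ih =>
    obtain ⟨D, C₁, hD, t₁, h₁⟩ := ih (by omega)
    obtain ⟨D', C₂, hD', t₂, h₂⟩ := append_pixel hr (by omega) h₁
    exact ⟨_, C₂, by rw [List.length_append]; omega, t₁.append t₂, h₂⟩

/-- Moving a complete row to the chamber, and the storage down by one level. -/
theorem transfer {C : Configuration affinity} {r q : ℕ} (hw : 0 < w) (hr : r < h)
    (hC : Rest h w g r q (2 * w) w C) :
    ∃ C', TiltSequence [.E, .S, .W, .S] C C' ∧ Rest h w g (r + 1) 0 0 0 C' := by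
  obtain ⟨C₁, t₁, h₁⟩ := tilt_east_row hw hr hC
  obtain ⟨C₂, t₂, h₂⟩ : ∃ C', Tilt .S C₁ C' ∧ Shows h w C' (Present h w (r + 1) 0 0)
      (blocks h w g (r + 1) 0 (posX (r + 1) 0 1 1) (posY (r + 1) (fun _ => 4) 2)
        (-w - 1) 0 2 (-h - 1)) := by
    have h₁' : Shows h w C₁ (Present h w r (2 * w) w)
        (blocks h w g r w (posX r q 0 1) (posY r (fun _ => 2) 0) 2 0 2 (-h - 1)) := by
      -- The conveyor is empty, so the heights prescribed for its tiles can be changed freely.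
      refine h₁.congr (fun _ => Iff.rfl) ?_
      rintro (⟨i, j⟩ | _ | _) hi <;> simp only [Present, blocks, posY, Block.mk.injEq] at *
      simp only [true_and, and_true]
      split_ifs <;> omega
    rcases Nat.eq_zero_or_pos r with rfl | hr0
    · exact tilt_south_first hw hr h₁'
    · exact tilt_south_join hw hr hr0 h₁'
  obtain ⟨C₃, t₃, h₃⟩ := tilt_west_rect hw hr h₂
  obtain ⟨C₄, t₄, h₄⟩ := tilt_south_settle hw hr (by omega) le_rfl (by push_cast; omega) h₃
  exact ⟨C₄, .cons t₁ (.cons t₂ (.cons t₃ (.cons t₄ (.nil _)))), h₄⟩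

/-- Four tilts fetch the first tile, ten serve each column, and four transfer the row. -/
theorem append_row {C : Configuration affinity} {r : ℕ} (hw : 0 < w) (hr : r < h)
    (hC : Rest h w g r 0 0 0 C) :
    ∃ D C', D.length = 10 * w + 8 ∧ TiltSequence D C C' ∧ Rest h w g (r + 1) 0 0 0 C' := by
  obtain ⟨C₁, t₁, h₁⟩ := advance_idle hw hr (by omega) hC
  obtain ⟨D, C₂, hD, t₂, h₂⟩ := append_pixels hr h₁ w le_rfl
  obtain ⟨C₃, t₃, h₃⟩ := transfer hw hr h₂
  refine ⟨_, C₃, ?_, t₁.append (t₂.append t₃), h₃⟩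
  simp [hD]

theorem append_rows {C : Configuration affinity} (hw : 0 < w) (hC : Rest h w g 0 0 0 0 C)
    (r : ℕ) (hr : r ≤ h) :
    ∃ D C', D.length = r * (10 * w + 8) ∧ TiltSequence D C C' ∧ Rest h w g r 0 0 0 C' := by
  induction r with
  | zero => exact ⟨[], C, by simp, .nil C, hC⟩
  | succ r ih =>
    obtain ⟨D, C₁, hD, t₁, h₁⟩ := ih (by omega)
    obtain ⟨D', C₂, hD', t₂, h₂⟩ := append_row hw (by omega) h₁
    exact ⟨_, C₂, by rw [List.length_append, hD, hD']; ring, t₁.append t₂, h₂⟩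

theorem Rest.stronglyRepresents {C : Configuration affinity} (hh : 0 < h)
    {f : Loc → Fin 2} (hC : Rest h w (fun X Y => f (X + 1, Y + 1)) h 0 0 0 C) :
    StronglyRepresents Label.pixel C {q : Loc × Fin 2 | q.1 ∈ box w h ∧ q.2 = f q.1} := by
  -- The finished rectangle has its corner at `(w + 4, 2)`, and the pattern has it at `(1, 1)`.
  refine ⟨(w + 3, 1), hC.2.trans ?_⟩
  have hI : {i | Present h w h 0 0 i} = {Idx.rect} := by
    ext i
    rcases i with ⟨i, j⟩ | _ | _ <;> simp [Present] <;> omega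
  rw [hI, Set.image_singleton]
  congr 1
  ext ⟨⟨X, Y⟩, l⟩
  simp only [cells, Has, blocks, Set.mem_ofPred_eq, Set.mem_image, Prod.mk.injEq, Prod.exists,
    mem_box, Prod.mk_add_mk]
  constructor
  · rintro ⟨hX, rfl⟩
    refine ⟨X - (w + 3), Y - 1, _, ⟨by omega, rfl⟩, ⟨by omega, by omega⟩, ?_⟩
    congr 3 <;> omega
  · rintro ⟨X', Y', x, ⟨hX, rfl⟩, ⟨rfl, rfl⟩, rfl⟩
    refine ⟨by omega, ?_⟩
    congr 3 <;> omega

/-- The initial configuration of the machine. -/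
def start (h w : ℕ) : Configuration affinity where
  board := board h w
  polys := {P | ∃ i j, i < h ∧ j < 2 * w ∧
    P = {((posX 0 0 0 0 i j + (w + 3), posY 0 (fun _ => 2) 0 i j + (h + 3)), .pixel (sym j))}}
  isPolyomino := by
    rintro _ ⟨i, j, -, -, rfl⟩
    refine ⟨Set.finite_singleton _, Set.injOn_singleton _ _, ?_⟩
    have : Nonempty ({((posX 0 0 0 0 i j + (w + 3), posY 0 (fun _ => 2) 0 i j + (h + 3)),
      .pixel (sym j))} : Set (Tile Label)) := ⟨⟨_, rfl⟩⟩
    refine SimpleGraph.Connected.mk ?_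
    rintro ⟨_, rfl⟩ ⟨_, rfl⟩
    rfl
  onOpen := by
    rintro _ ⟨i, j, hi, hj, rfl⟩ _ rfl
    apply mem_openLocs <;> simp only [posX, posY]
    · split_ifs <;> omega
    · apply IsOpen.conveyor <;> split_ifs at * <;> omega
  nonoverlap := by
    rintro _ ⟨i, j, hi, hj, rfl⟩ _ ⟨i', j', hi', hj', rfl⟩ _ rfl _ rfl he
    obtain ⟨rfl, rfl⟩ : i = i' ∧ j = j' := by
      simp only [Prod.mk.injEq, posX, posY] at he
      split_ifs at he <;> omega
    rfl

/-- The target `g` only enters the labels of the row and of the completed rows, both absent here.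
One start therefore serves all patterns. -/
theorem rest_start (h w : ℕ) (g : ℤ → ℤ → Fin 2) : Rest h w g 0 0 0 0 (start h w) := by
  refine ⟨rfl, ?_⟩
  have key : ∀ i j, (blocks h w g 0 0 (posX 0 0 0 0)
      (posY 0 (fun j => if j + 1 = 0 then 0 else 2) 0) (-w - 1) 0 1 (-h - 1) (.tile i j)).cells =
      {((posX 0 0 0 0 i j + (w + 3), posY 0 (fun _ => 2) 0 i j + (h + 3)), .pixel (sym j))} := by
    intro i j
    ext ⟨⟨X, Y⟩, l⟩
    simp only [cells, Has, blocks, Set.mem_ofPred_eq, Set.mem_singleton_iff, Prod.mk.injEq, posY,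
      Nat.add_eq_zero_iff, one_ne_zero, and_false, if_false]
    refine and_congr_left fun _ => ?_
    omega
  ext P
  constructor
  · rintro ⟨i, j, hi, hj, rfl⟩
    exact ⟨.tile i j, ⟨hi, hj, by omega⟩, key i j⟩
  · rintro ⟨⟨i, j⟩ | _ | _, hi, rfl⟩
    · exact ⟨i, j, hi.1, hi.2.1, key i j⟩
    · exact absurd hi (lt_irrefl 0)
    · exact absurd hi (lt_irrefl 0)

end Machine
end TiltModel

theorem mainTheorem1 :
    ∃ K : ℕ, ∀ h w : ℕ, 0 < h → 0 < w →
      ∃ C : TiltModel.Configuration TiltModel.affinity,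
        (∀ P ∈ C.polys, ∃ t, P = {t}) ∧
        TiltModel.IsStronglyUniversal TiltModel.Label.pixel C
          (TiltModel.rectPatterns h w (Fin 2)) ∧
        C.size ≤ K * (h * w) ∧
        ∀ u ∈ TiltModel.rectPatterns h w (Fin 2),
          ∃ (D : List TiltModel.Dir) (C' : TiltModel.Configuration TiltModel.affinity),
            D.length ≤ K * (h * w) ∧ TiltModel.TiltSequence D C C' ∧
              TiltModel.StronglyRepresents TiltModel.Label.pixel C' u := by
  -- `9 * w + 5 ≤ 14 * w` and `5 * h + 4 ≤ 9 * h` give `126 = 14 * 9`; the tilt count needs only 18.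
  refine ⟨126, fun h w hh hw => ⟨TiltModel.Machine.start h w, ?_, ?_⟩⟩
  · rintro P ⟨i, j, -, -, rfl⟩
    exact ⟨_, rfl⟩
  have key : ∀ u ∈ TiltModel.rectPatterns h w (Fin 2),
      ∃ (D : List TiltModel.Dir) (C' : TiltModel.Configuration TiltModel.affinity),
        D.length = h * (10 * w + 8) ∧ TiltModel.TiltSequence D (TiltModel.Machine.start h w) C' ∧
          TiltModel.StronglyRepresents TiltModel.Label.pixel C' u := by
    rintro _ ⟨f, rfl⟩
    obtain ⟨D, C', hD, hT, hC'⟩ := TiltModel.Machine.append_rows hw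
      (TiltModel.Machine.rest_start h w fun X Y => f (X + 1, Y + 1)) h le_rfl
    exact ⟨D, C', hD, hT, hC'.stronglyRepresents hh⟩
  -- Taking all reachable configurations makes universality trivial; it remains to reach each
  -- pattern by a nonempty sequence.
  refine ⟨⟨{C' | TiltModel.Reconfigurable (TiltModel.Machine.start h w) C'}, ?_, fun C' h => h⟩,
    ?_, ?_⟩
  · intro u hu
    obtain ⟨D, C', hD, hT, hC'⟩ := key u hu
    refine ⟨C', hT.reconfigurable ?_, hC'⟩
    rintro rfl
    have : 0 < h * (10 * w + 8) := by positivity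
    simp_all
  · show (9 * w + 5) * (5 * h + 4) ≤ 126 * (h * w)
    nlinarith [Nat.mul_le_mul hh hw]
  · intro u hu
    obtain ⟨D, C', hD, hT, hC'⟩ := key u hu
    refine ⟨D, C', ?_, hT, hC'⟩
    rw [hD]
    nlinarith
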